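/- Let $1\le d\le 6$, $\alpha\ge 0$, and let $f:\mathbb R\to\mathbb R$ be an odd $C^1$ function with $f'(0)=0$; put $F(y)=\int_0^y f(s)\,ds$. Assume that (i) there is $\gamma>0$ such that $\int_{\mathbb R^d}\big(2(1+\gamma)F(\varphi)-\varphi f(\varphi)\big)\,dx\le 0$ for all $\varphi\in H^1(\mathbb R^d)$; (ii) there are constants $C,\beta,\theta$ with $1<\theta<\theta^*$ and $0<\beta<\theta-1$, where $\theta^*=\infty$ if $d\le 2$ and $\theta^*=\frac{d+2}{d-2}$ if $d\ge 3$, such that $|f'(y)|\le C\max(|y|^{\beta},|y|^{\theta-1})$ for all $y\in\mathbb R$. Consider the damped Klein–Gordon equation $$\partial_t^2u+2\alpha\,\partial_tu-\Delta u+u-f(u)=0\quad\text{on }\mathbb R^d .\qquad (*)$$ For $T\in(0,\infty]$, a solution of $(*)$ on $[0,T)$ is a pair $(u,\partial_tu)$ with $u\in C([0,T),H^1(\mathbb R^d))\cap C^1([0,T),L^2(\mathbb R^d))$ and $f(u)\in L^1((0,b),L^2(\mathbb R^d))$ for every $b\in[0,T)$, such that for all $\varphi\in H^1(\mathbb R^d)$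 and $t\in[0,T)$ $$\langle\partial_tu(t),\varphi\rangle_{L^2}-\langle\partial_tu(0),\varphi\rangle_{L^2}=\int_0^t\Big(-2\alpha\langle\partial_tu,\varphi\rangle_{L^2}-\langle\nabla u,\nabla\varphi\rangle_{L^2}-\langle u,\varphi\rangle_{L^2}+\int_{\mathbb R^d}f(u)\varphi\,dx\Big)ds .$$ It is maximal if it is not the restriction of a solution on some $[0,T')$ with $T'>T$. For $\varphi\in H^1(\mathbb R^d)$ let $$K_0(\varphi)=\int_{\mathbb R^d}\big(|\nabla\varphi|^2+\varphi^2-\varphi f(\varphi)\big)\,dx .$$ Let $(u,\partial_tu)$ be a maximal solution of $(*)$, defined on $[0,T^*)$ with $T^*\in(0,\infty]$. If there are $t_0\in[0,T^*)$ and $\delta>0$ such that $K_0(u(t))\le-\delta$ for all $t\in[t_0,T^*)$, then $T^*<\infty$, i.e. the solution blows up in finite time. -/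

import Mathlib

open MeasureTheory Set
open scoped ENNReal ContDiff

noncomputable section

namespace KleinGordon

/-- The Euclidean space `ℝ^d`. -/
abbrev Space (d : ℕ) : Type := EuclideanSpace ℝ (Fin d)

/-- The real Hilbert space `L²(ℝ^d)`. -/
abbrev L2 (d : ℕ) : Type := Lp ℝ 2 (volume : Measure (Space d))

/-- The real Hilbert space `L²(ℝ^d; ℝ^d)` of square integrable vector fields. -/
abbrev L2Field (d : ℕ) : Type := Lp (Space d) 2 (volume : Measure (Space d))

/-- `G` is the weak gradient of `u`: for every test function `φ ∈ C_c^∞(ℝ^d)` and every `i`,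
`∫ u ∂ᵢφ = - ∫ Gᵢ φ`. -/
def IsWeakGradient {d : ℕ} (u : L2 d) (G : L2Field d) : Prop :=
  ∀ φ : Space d → ℝ, ContDiff ℝ ∞ φ → HasCompactSupport φ → ∀ i : Fin d,
    ∫ x, u x * fderiv ℝ φ x (EuclideanSpace.single i 1) = - ∫ x, G x i * φ x

/-- A square integrable function times a continuous compactly supported one is integrable. -/
theorem integrable_mul_test {d : ℕ} {w φ : Space d → ℝ} (hw : MemLp w 2 volume)
    (hφ : Continuous φ) (hc : HasCompactSupport φ) : Integrable (fun x => w x * φ x) :=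
  MemLp.integrable_mul (p := 2) (q := 2) hw (hφ.memLp_of_hasCompactSupport hc)

theorem integrable_mul_deriv {d : ℕ} (u : L2 d) {φ : Space d → ℝ} (hφ : ContDiff ℝ ∞ φ)
    (hc : HasCompactSupport φ) (e : Space d) :
    Integrable (fun x => u x * fderiv ℝ φ x e) :=
  integrable_mul_test (Lp.memLp u)
    ((hφ.continuous_fderiv (by simp)).clm_apply continuous_const) (hc.fderiv_apply ℝ e)

theorem integrable_coord_mul {d : ℕ} (G : L2Field d) {φ : Space d → ℝ} (hφ : ContDiff ℝ ∞ φ)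
    (hc : HasCompactSupport φ) (i : Fin d) : Integrable (fun x => G x i * φ x) :=
  integrable_mul_test ((EuclideanSpace.proj (𝕜 := ℝ) i).comp_memLp' (Lp.memLp G))
    hφ.continuous hc

/-- The Sobolev space `H¹(ℝ^d)`, realized as the graph of the weak gradient: the pairs
`(u, ∇u)` with `u ∈ L²` whose weak gradient `∇u` is in `L²`. As a subspace of the Hilbert space
`L² × L²` it carries the norm `‖u‖²_{H¹} = ‖u‖²_{L²} + ‖∇u‖²_{L²}`. -/
def sobolevGraph (d : ℕ) : Submodule ℝ (WithLp 2 (L2 d × L2Field d)) where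
  carrier := {p | IsWeakGradient p.fst p.snd}
  zero_mem' := by
    intro φ _ _ i
    have h1 : ∫ x, (0 : L2 d) x * fderiv ℝ φ x (EuclideanSpace.single i 1) = 0 := by
      refine integral_eq_zero_of_ae ?_
      filter_upwards [Lp.coeFn_zero ℝ 2 (volume : Measure (Space d))] with x hx
      rw [hx]
      simp
    have h2 : ∫ x, (0 : L2Field d) x i * φ x = 0 := by
      refine integral_eq_zero_of_ae ?_
      filter_upwards [Lp.coeFn_zero (Space d) 2 (volume : Measure (Space d))] with x hx
      rw [hx]
      simp
    simp only [WithLp.zero_fst, WithLp.zero_snd]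
    rw [h1, h2, neg_zero]
  add_mem' := by
    intro p q hp hq φ hφ hc i
    have h1 : ∫ x, (p.fst + q.fst) x * fderiv ℝ φ x (EuclideanSpace.single i 1)
        = (∫ x, p.fst x * fderiv ℝ φ x (EuclideanSpace.single i 1))
          + ∫ x, q.fst x * fderiv ℝ φ x (EuclideanSpace.single i 1) := by
      rw [← integral_add (integrable_mul_deriv _ hφ hc _) (integrable_mul_deriv _ hφ hc _)]
      refine integral_congr_ae ?_
      filter_upwards [Lp.coeFn_add p.fst q.fst] with x hx
      rw [hx, Pi.add_apply]
      simp [add_mul]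
    have h2 : ∫ x, (p.snd + q.snd) x i * φ x
        = (∫ x, p.snd x i * φ x) + ∫ x, q.snd x i * φ x := by
      rw [← integral_add (integrable_coord_mul _ hφ hc _) (integrable_coord_mul _ hφ hc _)]
      refine integral_congr_ae ?_
      filter_upwards [Lp.coeFn_add p.snd q.snd] with x hx
      rw [hx, Pi.add_apply]
      simp [add_mul]
    simp only [WithLp.add_fst, WithLp.add_snd]
    rw [h1, h2, hp φ hφ hc i, hq φ hφ hc i]
    ring
  smul_mem' := by
    intro c p hp φ hφ hc i
    have h1 : ∫ x, (c • p.fst) x * fderiv ℝ φ x (EuclideanSpace.single i 1)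
        = c * ∫ x, p.fst x * fderiv ℝ φ x (EuclideanSpace.single i 1) := by
      rw [← integral_const_mul]
      refine integral_congr_ae ?_
      filter_upwards [Lp.coeFn_smul c p.fst] with x hx
      simp [hx, mul_assoc]
    have h2 : ∫ x, (c • p.snd) x i * φ x = c * ∫ x, p.snd x i * φ x := by
      rw [← integral_const_mul]
      refine integral_congr_ae ?_
      filter_upwards [Lp.coeFn_smul c p.snd] with x hx
      simp [hx, mul_assoc]
    simp only [WithLp.smul_fst, WithLp.smul_snd]
    rw [h1, h2, hp φ hφ hc i]
    ring

/-- The Hilbert space `H¹(ℝ^d)`. -/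
abbrev H1 (d : ℕ) : Type := sobolevGraph d

/-- The underlying `L²` function of an element of `H¹`. -/
abbrev H1.fn {d : ℕ} (φ : H1 d) : L2 d := (φ : WithLp 2 (L2 d × L2Field d)).fst

/-- The weak gradient of an element of `H¹`. -/
abbrev H1.grad {d : ℕ} (φ : H1 d) : L2Field d := (φ : WithLp 2 (L2 d × L2Field d)).snd

/-- The primitive `F(y) = ∫₀^y f(s) ds`. -/
def primitive (f : ℝ → ℝ) (y : ℝ) : ℝ := ∫ s in (0 : ℝ)..y, f s

/-- The Ambrosetti–Rabinowitz type condition: for some `γ > 0`,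
`∫ 2(1 + γ) F(φ) - φ f(φ) ≤ 0` for all `φ ∈ H¹(ℝ^d)`. -/
def AmbrosettiRabinowitz (d : ℕ) (f : ℝ → ℝ) : Prop :=
  ∃ γ : ℝ, 0 < γ ∧ ∀ φ : H1 d,
    ∫ x, (2 * (1 + γ) * primitive f (φ.fn x) - φ.fn x * f (φ.fn x)) ≤ 0

/-- The energy subcritical growth condition `|f'(y)| ≤ C max(|y|^β, |y|^(θ-1))` for some
`1 < θ < θ*` and `0 < β < θ - 1`, where `θ* = ∞` if `d ≤ 2` and `θ* = (d+2)/(d-2)` if `d ≥ 3`. -/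
def SubcriticalGrowth (d : ℕ) (f : ℝ → ℝ) : Prop :=
  ∃ C β θ : ℝ, 1 < θ ∧ (3 ≤ d → θ < ((d : ℝ) + 2) / ((d : ℝ) - 2)) ∧ 0 < β ∧ β < θ - 1 ∧
    ∀ y : ℝ, |deriv f y| ≤ C * max (|y| ^ β) (|y| ^ (θ - 1))

/-- The functional `K₀(φ) = ∫ |∇φ|² + φ² - φ f(φ)` on `H¹(ℝ^d)`. -/
def K0 {d : ℕ} (f : ℝ → ℝ) (φ : H1 d) : ℝ :=
  ∫ x, (‖φ.grad x‖ ^ 2 + (φ.fn x) ^ 2 - φ.fn x * f (φ.fn x))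

/-- The time interval `[0, T)`, where `T` may be `∞`. -/
def timeInterval (T : EReal) : Set ℝ := {t | 0 ≤ t ∧ (t : EReal) < T}

/-- `(u, v) = (u, ∂ₜu)` is a solution on `[0, T)`, `0 < T ≤ ∞`, of
`∂ₜ²u + 2α ∂ₜu - Δu + u - f(u) = 0` with values in `H¹(ℝ^d) × L²(ℝ^d)`:
`u ∈ C([0,T), H¹) ∩ C¹([0,T), L²)` with `∂ₜu = v`, the source `f(u)` is in
`L¹((0,b), L²(ℝ^d))` for every `b ∈ [0, T)` (so that Duhamel's formula makes sense in `H¹ × L²`),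
and the equation holds, integrated in time, when tested against `H¹(ℝ^d)`. -/
structure IsSolution {d : ℕ} (α : ℝ) (f : ℝ → ℝ) (T : EReal) (u : ℝ → H1 d) (v : ℝ → L2 d) :
    Prop where
  pos : 0 < T
  continuousOn_u : ContinuousOn u (timeInterval T)
  continuousOn_v : ContinuousOn v (timeInterval T)
  hasDeriv : ∀ t ∈ timeInterval T,
    HasDerivWithinAt (fun s => (u s).fn) (v t) (timeInterval T) t
  source : ∀ b ∈ timeInterval T,
    ∫⁻ t in Icc 0 b, eLpNorm (fun x => f ((u t).fn x)) 2 volume < ⊤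
  equation : ∀ φ : H1 d, ∀ t ∈ timeInterval T,
    inner ℝ (v t) φ.fn - inner ℝ (v 0) φ.fn =
      ∫ s in (0 : ℝ)..t,
        (-(2 * α * inner ℝ (v s) φ.fn) - inner ℝ (u s).grad φ.grad - inner ℝ (u s).fn φ.fn
          + ∫ x, f ((u s).fn x) * φ.fn x)

/-- A solution on `[0, T)` is maximal if no solution on a longer interval `[0, T')` extends it. -/
structure IsMaximalSolution {d : ℕ} (α : ℝ) (f : ℝ → ℝ) (T : EReal) (u : ℝ → H1 d)
    (v : ℝ → L2 d) : Prop where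
  isSolution : IsSolution α f T u v
  maximal : ∀ (T' : EReal) (u' : ℝ → H1 d) (v' : ℝ → L2 d), IsSolution α f T' u' v' →
    (∀ t ∈ timeInterval T, u' t = u t) → T' ≤ T

end KleinGordon

end

/-! Suppose the solution were global. Write `A = ‖∂ₜu‖²`, `B = ‖u‖²` in `H¹`, `y = ‖u‖²` in `L²`, `X
= ∫ u f(u)`, and let `N` be the integral of `A` from a time `a > 0`. Levine's concavity method is
applied to `Φ = y + 2α ∫ y + 1`, the integral also starting at `a`. Its derivative is `D = 2⟨∂ₜu, u⟩
+ 2αy`, and the equation gives, in integrated form, `D' = 2(A - B + X)`.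

The bound on `K₀` gives `D' ≥ 2δ`, so `D` tends to infinity; since `D = y' + 2αy`, so does `y`
(`eventually_ge_of_damped`). The energy identity expresses `2 ∫ F(u)` as `A + B - E + 4αN`, where
`E` is twice the energy at time `a`. Condition (i) then bounds `D'` below by a continuous `m`, which
for `y` large dominates `(4 + 2γ)(A + 2αN + const)`. By Cauchy–Schwarz (`sq_pairing_le`), `m Φ ≥ (1
+ γ/2) D²`, so `Φ ^ (-γ/2)` would reach zero in finite time (`false_of_concavity`).

The analytic work is to justify the two identities for weak solutions. Since `∂ₜu` is only in `L²`,
it is not an admissible test function; averaging forward in time repairs this (`WeakFlow.energy_eq`,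
`WeakFlow.pairing_eq`). Since `f(u)` is only `L¹` in time with values in `L²`, the chain rule for `∫
F(u)` is proved for Lipschitz truncations of `f` and passed to the limit (`potential_sub_eq`). The
integrals of `F(u)` and `u f(u)` converge by the Sobolev embedding `H1.integrable_abs_rpow`. -/

open Filter Topology
open scoped NNReal Convolution

namespace KleinGordon

/-! ### Forward time averages and their convergence. -/

section Average

variable {H : Type*} [NormedAddCommGroup H] [NormedSpace ℝ H]

/-- The forward average `h⁻¹ ∫_t^{t+h} g`. -/
noncomputable def fwdAvg (h : ℝ) (g : ℝ → H) (t : ℝ) : H := h⁻¹ • ∫ s in t..t + h, g s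

theorem fwdAvg_eq {g : ℝ → H} (hg : ∀ a b, IntervalIntegrable g volume a b) (h t : ℝ) :
    fwdAvg h g t = h⁻¹ • ((∫ s in (0 : ℝ)..t + h, g s) - ∫ s in (0 : ℝ)..t, g s) := by
  rw [fwdAvg, intervalIntegral.integral_interval_sub_left (hg _ _) (hg _ _)]

theorem continuous_fwdAvg {g : ℝ → H} (hg : ∀ a b, IntervalIntegrable g volume a b) (h : ℝ) :
    Continuous (fwdAvg h g) := by
  have hc := intervalIntegral.continuous_primitive hg 0
  have : fwdAvg h g = fun t => h⁻¹ • ((∫ s in (0 : ℝ)..t + h, g s) - ∫ s in (0 : ℝ)..t, g s) :=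
    funext fun t => fwdAvg_eq hg h t
  rw [this]
  exact ((hc.comp (continuous_id.add continuous_const)).sub hc).const_smul _

theorem fwdAvg_sub {g g' : ℝ → H} (hg : ∀ a b, IntervalIntegrable g volume a b)
    (hg' : ∀ a b, IntervalIntegrable g' volume a b) (h t : ℝ) :
    fwdAvg h (fun s => g s - g' s) t = fwdAvg h g t - fwdAvg h g' t := by
  simp only [fwdAvg]
  rw [intervalIntegral.integral_sub (hg _ _) (hg' _ _), smul_sub]

theorem hasDerivAt_fwdAvg [CompleteSpace H] {g : ℝ → H} (hg : Continuous g) (h t : ℝ) :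
    HasDerivAt (fwdAvg h g) (h⁻¹ • (g (t + h) - g t)) t := by
  have : fwdAvg h g = fun t => h⁻¹ • ((∫ s in (0 : ℝ)..t + h, g s) - ∫ s in (0 : ℝ)..t, g s) :=
    funext fun t => fwdAvg_eq (fun a b => hg.intervalIntegrable a b) h t
  rw [this]
  have h1 := (hg.integral_hasStrictDerivAt 0 t).hasDerivAt
  have h2 := ((hg.integral_hasStrictDerivAt 0 (t + h)).hasDerivAt).comp_add_const t h
  exact (h2.sub h1).const_smul _

theorem norm_fwdAvg_le {h : ℝ} (hh : 0 < h) (g : ℝ → H) (t : ℝ) :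
    ‖fwdAvg h g t‖ ≤ fwdAvg h (fun s => ‖g s‖) t := by
  simp only [fwdAvg, norm_smul, smul_eq_mul, Real.norm_eq_abs, abs_of_pos (inv_pos.2 hh)]
  gcongr
  exact intervalIntegral.norm_integral_le_integral_norm (by linarith)

/-- With `A` a primitive of `φ`, the left side is a difference of averages of `A` over `[b, b + h]`
and `[a, a + h]`. Since `φ ≥ 0`, `A` is monotone, and the averages are compared with `A (b + h)` and
`A a`. -/
theorem integral_fwdAvg_le {φ : ℝ → ℝ} (hφ : ∀ a b, IntervalIntegrable φ volume a b)
    (h0 : ∀ t, 0 ≤ φ t) {a b h : ℝ} (hh : 0 < h) :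
    ∫ t in a..b, fwdAvg h φ t ≤ ∫ t in a..b + h, φ t := by
  set A : ℝ → ℝ := fun t => ∫ s in (0 : ℝ)..t, φ s with hA
  have hAc : Continuous A := intervalIntegral.continuous_primitive hφ 0
  have hAm : Monotone A := by
    intro s t hst
    have : A t - A s = ∫ r in s..t, φ r :=
      intervalIntegral.integral_interval_sub_left (hφ _ _) (hφ _ _)
    have := intervalIntegral.integral_nonneg (μ := volume) hst (fun r _ => h0 r)
    linarith
  have hAi : ∀ a b, IntervalIntegrable A volume a b := fun a b => hAc.intervalIntegrable a b
  have e1 : ∫ t in a..b, fwdAvg h φ t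
      = h⁻¹ * ((∫ t in b..b + h, A t) - ∫ t in a..a + h, A t) := by
    have : ∀ t, fwdAvg h φ t = h⁻¹ * (A (t + h) - A t) := fun t => by
      rw [fwdAvg_eq hφ]; rfl
    simp_rw [this]
    rw [intervalIntegral.integral_const_mul, intervalIntegral.integral_sub
      (f := fun t => A (t + h))
      ((hAc.comp (continuous_id.add continuous_const)).intervalIntegrable _ _) (hAi _ _),
      intervalIntegral.integral_comp_add_right (fun t => A t)]
    have h1 := intervalIntegral.integral_add_adjacent_intervals (hAi a (a + h)) (hAi (a + h) (b + h))
    have h2 := intervalIntegral.integral_add_adjacent_intervals (hAi a b) (hAi b (b + h))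
    congr 1
    linarith
  have e2 : ∫ t in b..b + h, A t ≤ h * A (b + h) := by
    have := intervalIntegral.integral_mono_on (by linarith) (hAi b (b + h))
      (continuous_const.intervalIntegrable (μ := volume) b (b + h) : IntervalIntegrable
        (fun _ => A (b + h)) volume b (b + h)) (fun x hx => hAm hx.2)
    simpa using this
  have e3 : h * A a ≤ ∫ t in a..a + h, A t := by
    have := intervalIntegral.integral_mono_on (by linarith)
      (continuous_const.intervalIntegrable (μ := volume) a (a + h) : IntervalIntegrable
        (fun _ => A a) volume a (a + h)) (hAi a (a + h)) (fun x hx => hAm hx.1)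
    simpa using this
  have e4 : A (b + h) - A a = ∫ r in a..b + h, φ r :=
    intervalIntegral.integral_interval_sub_left (hφ _ _) (hφ _ _)
  rw [e1, ← e4, inv_mul_le_iff₀ hh]
  linarith

theorem norm_fwdAvg_sub_le [CompleteSpace H] {g : ℝ → H}
    (hg : ∀ a b, IntervalIntegrable g volume a b) {h t ε : ℝ} (hh : 0 < h) (c : H)
    (hε : ∀ s ∈ Icc t (t + h), ‖g s - c‖ ≤ ε) : ‖fwdAvg h g t - c‖ ≤ ε := by
  have e : fwdAvg h g t - c = h⁻¹ • ∫ s in t..t + h, (g s - c) := by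
    rw [intervalIntegral.integral_sub (hg _ _) (by simp), smul_sub, fwdAvg]
    simp [smul_smul, inv_mul_cancel₀ hh.ne']
  rw [e, norm_smul, Real.norm_eq_abs, abs_of_pos (inv_pos.2 hh), inv_mul_le_iff₀ hh]
  have := intervalIntegral.norm_integral_le_of_norm_le_const (a := t) (b := t + h)
    (f := fun s => g s - c) (C := ε) (fun s hs => hε s (by
      rw [uIoc_of_le (by linarith)] at hs; exact ⟨hs.1.le, hs.2⟩))
  simpa [abs_of_pos hh, mul_comm] using this

theorem eventually_norm_fwdAvg_sub_le [CompleteSpace H] {g : ℝ → H} (hg : Continuous g) (a b : ℝ)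
    {ε : ℝ} (hε : 0 < ε) :
    ∀ᶠ h in 𝓝[>] (0 : ℝ), ∀ t ∈ Icc a b, ‖fwdAvg h g t - g t‖ ≤ ε := by
  have huc := (isCompact_Icc (a := a) (b := b + 1)).uniformContinuousOn_of_continuous
    hg.continuousOn
  obtain ⟨δ, hδ, H⟩ := Metric.uniformContinuousOn_iff_le.1 huc ε hε
  filter_upwards [Ioc_mem_nhdsGT (lt_min hδ one_pos)] with h hh t ht
  have h1 := le_min_iff.1 hh.2
  refine norm_fwdAvg_sub_le (fun a b => hg.intervalIntegrable a b) hh.1 _ fun s hs => ?_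
  rw [← dist_eq_norm]
  refine H s ⟨ht.1.trans hs.1, ?_⟩ t ⟨ht.1, ?_⟩ ?_
  · linarith [hs.2, ht.2]
  · linarith [ht.2]
  · rw [Real.dist_eq, abs_of_nonneg (by linarith [hs.1])]
    linarith [hs.2]

/-- Density argument: convergence is uniform for continuous `g`, and averaging is an `L¹`
contraction once the interval is enlarged by `h`, here at most `1`. -/
theorem tendsto_integral_norm_fwdAvg_sub [CompleteSpace H] {g : ℝ → H}
    (hg : ∀ a b, IntervalIntegrable g volume a b) {a b : ℝ} (hab : a ≤ b) :
    Tendsto (fun h => ∫ t in a..b, ‖fwdAvg h g t - g t‖) (𝓝[>] 0) (𝓝 0) := by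
  rw [Metric.tendsto_nhds]
  intro ε hε
  have hgi : Integrable ((Ioc a (b + 1)).indicator g) := by
    rw [integrable_indicator_iff measurableSet_Ioc]
    exact (intervalIntegrable_iff_integrableOn_Ioc_of_le (by linarith)).1 (hg a (b + 1))
  have hη : 0 < ε / (4 * (b - a + 1)) := by
    have : 0 < b - a + 1 := by linarith
    positivity
  obtain ⟨k, -, hk, hkc, hki⟩ := hgi.exists_hasCompactSupport_integral_sub_le
    (show (0 : ℝ) < ε / 4 by linarith)
  have hkI : ∀ a b, IntervalIntegrable k volume a b := fun a b => hkc.intervalIntegrable a b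
  have hdI : ∀ a b, IntervalIntegrable (fun t => ‖g t - k t‖) volume a b :=
    fun a b => ((hg a b).sub (hkI a b)).norm
  have hgk : ∫ t in a..b + 1, ‖g t - k t‖ ≤ ε / 4 := by
    refine le_trans ?_ hk
    rw [intervalIntegral.integral_of_le (by linarith)]
    refine le_trans (le_of_eq ?_) (setIntegral_le_integral (s := Ioc a (b + 1))
      (hgi.sub hki).norm (Eventually.of_forall fun x => norm_nonneg _))
    refine setIntegral_congr_fun measurableSet_Ioc fun x hx => ?_
    simp [indicator_of_mem hx]
  filter_upwards [eventually_norm_fwdAvg_sub_le hkc a b hη, Ioc_mem_nhdsGT (one_pos)] with h hu hh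
  have hmono : ∀ c, b ≤ c → c ≤ b + 1 → ∫ t in a..c, ‖g t - k t‖ ≤ ε / 4 := by
    intro c hc hc'
    refine le_trans ?_ hgk
    exact intervalIntegral.integral_mono_interval le_rfl (by linarith) hc'
      (Eventually.of_forall fun x => norm_nonneg _) (hdI _ _)
  have b1 : ∫ t in a..b, ‖fwdAvg h g t - fwdAvg h k t‖ ≤ ε / 4 := by
    refine le_trans ?_ (hmono (b + h) (by linarith [hh.1]) (by linarith [hh.2]))
    refine le_trans ?_ (integral_fwdAvg_le hdI (fun t => norm_nonneg _) hh.1)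
    refine intervalIntegral.integral_mono_on hab ?_ ?_ fun t _ => ?_
    · exact ((continuous_fwdAvg hg h).sub (continuous_fwdAvg hkI h)).norm.intervalIntegrable _ _
    · exact (continuous_fwdAvg hdI h).intervalIntegrable _ _
    · rw [← fwdAvg_sub hg hkI]
      exact norm_fwdAvg_le hh.1 _ t
  have b2 : ∫ t in a..b, ‖fwdAvg h k t - k t‖ ≤ ε / 4 := by
    have := intervalIntegral.integral_mono_on hab
      (((continuous_fwdAvg hkI h).sub hkc).norm.intervalIntegrable _ _)
      (continuous_const.intervalIntegrable (μ := volume) a b : IntervalIntegrable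
        (fun _ => ε / (4 * (b - a + 1))) volume a b) (fun x hx => hu x hx)
    refine this.trans ?_
    simp only [intervalIntegral.integral_const, smul_eq_mul]
    have : 0 < b - a + 1 := by linarith
    rw [mul_div_assoc', div_le_div_iff₀ (by positivity) (by norm_num)]
    nlinarith
  have b3 : ∫ t in a..b, ‖g t - k t‖ ≤ ε / 4 := hmono b le_rfl (by linarith)
  have hI1 : IntervalIntegrable (fun t => ‖fwdAvg h g t - fwdAvg h k t‖) volume a b :=
    ((continuous_fwdAvg hg h).sub (continuous_fwdAvg hkI h)).norm.intervalIntegrable _ _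
  have hI2 : IntervalIntegrable (fun t => ‖fwdAvg h k t - k t‖) volume a b :=
    ((continuous_fwdAvg hkI h).sub hkc).norm.intervalIntegrable _ _
  have key : ∫ t in a..b, ‖fwdAvg h g t - g t‖ ≤
      ∫ t in a..b, (‖fwdAvg h g t - fwdAvg h k t‖ + ‖fwdAvg h k t - k t‖ + ‖g t - k t‖) := by
    refine intervalIntegral.integral_mono_on hab ?_ ((hI1.add hI2).add (hdI a b)) fun t _ => ?_
    · exact (((continuous_fwdAvg hg h).intervalIntegrable _ _).sub (hg a b)).norm
    · have : fwdAvg h g t - g t =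
        (fwdAvg h g t - fwdAvg h k t) + (fwdAvg h k t - k t) - (g t - k t) := by abel
      rw [this]
      exact (norm_sub_le _ _).trans (add_le_add_left (norm_add_le _ _) _)
  rw [intervalIntegral.integral_add (hI1.add hI2) (hdI a b), intervalIntegral.integral_add hI1 hI2]
    at key
  have hnn : 0 ≤ ∫ t in a..b, ‖fwdAvg h g t - g t‖ :=
    intervalIntegral.integral_nonneg hab fun t _ => norm_nonneg _
  rw [Real.dist_eq, sub_zero, abs_of_nonneg hnn]
  linarith

end Average

/-! ### Limits of time integrals of inner products. -/

section Inner

variable {H : Type*} [NormedAddCommGroup H] [InnerProductSpace ℝ H]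

theorem intervalIntegrable_inner {g w : ℝ → H} {a b : ℝ} (hg : IntervalIntegrable g volume a b)
    (hw : Continuous w) : IntervalIntegrable (fun t => inner ℝ (g t) (w t)) volume a b := by
  obtain ⟨M, hM⟩ := (isCompact_uIcc (a := a) (b := b)).exists_bound_of_continuousOn hw.continuousOn
  rw [intervalIntegrable_iff] at hg ⊢
  refine (hg.norm.mul_const M).mono' (hg.aestronglyMeasurable.inner (𝕜 := ℝ)
    hw.aestronglyMeasurable.restrict) ?_
  refine (ae_restrict_iff' measurableSet_uIoc).2 (Eventually.of_forall fun t ht => ?_)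
  refine (norm_inner_le_norm _ _).trans ?_
  gcongr
  exact hM t (uIoc_subset_uIcc ht)

/-- The first factor converges in `L¹` and the second uniformly, so merely integrable sources can be
handled. -/
theorem tendsto_integral_inner_fwdAvg [CompleteSpace H] {g : ℝ → H}
    (hg : ∀ a b, IntervalIntegrable g volume a b) {a b : ℝ} (hab : a ≤ b)
    {w : ℝ → H} (hw : Continuous w) {wh : ℝ → ℝ → H} (hwh : ∀ h, Continuous (wh h))
    (hu : ∀ ε > 0, ∀ᶠ h in 𝓝[>] (0 : ℝ), ∀ t ∈ Icc a b, ‖wh h t - w t‖ ≤ ε) :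
    Tendsto (fun h => ∫ t in a..b, inner ℝ (fwdAvg h g t) (wh h t)) (𝓝[>] 0)
      (𝓝 (∫ t in a..b, inner ℝ (g t) (w t))) := by
  obtain ⟨M, hM⟩ := (isCompact_Icc (a := a) (b := b)).exists_bound_of_continuousOn hw.continuousOn
  set G := ∫ t in a..b, ‖g t‖ with hG
  have hG0 : 0 ≤ G := intervalIntegral.integral_nonneg hab fun t _ => norm_nonneg _
  rw [tendsto_iff_norm_sub_tendsto_zero, Metric.tendsto_nhds]
  intro ε hε
  have hη : 0 < min 1 (ε / (2 * (G + 1))) := lt_min one_pos (by positivity)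
  have hL := ((tendsto_integral_norm_fwdAvg_sub hg hab).const_mul (|M| + 1))
  rw [mul_zero] at hL
  filter_upwards [hu _ hη, (Metric.tendsto_nhds.1 hL) (ε / 2) (by linarith)] with h h1 h2
  have hgh := continuous_fwdAvg hg h
  have hI : IntervalIntegrable (fun t => ‖fwdAvg h g t - g t‖) volume a b :=
    ((hgh.intervalIntegrable _ _).sub (hg a b)).norm
  have hnn : 0 ≤ ∫ t in a..b, ‖fwdAvg h g t - g t‖ :=
    intervalIntegral.integral_nonneg hab fun t _ => norm_nonneg _
  rw [Real.dist_eq, sub_zero, abs_of_nonneg (by positivity)] at h2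
  rw [Real.dist_eq, sub_zero, abs_of_nonneg (norm_nonneg _),
    ← intervalIntegral.integral_sub (intervalIntegrable_inner (hgh.intervalIntegrable _ _) (hwh h))
      (intervalIntegrable_inner (hg a b) hw)]
  have key : ‖∫ t in a..b, (inner ℝ (fwdAvg h g t) (wh h t) - inner ℝ (g t) (w t))‖ ≤
      ∫ t in a..b, ((|M| + 1) * ‖fwdAvg h g t - g t‖ + (ε / (2 * (G + 1))) * ‖g t‖) := by
    refine intervalIntegral.norm_integral_le_of_norm_le hab (Eventually.of_forall fun t ht => ?_)
      ((hI.const_mul _).add ((hg a b).norm.const_mul _))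
    have ht' : t ∈ Icc a b := ⟨ht.1.le, ht.2⟩
    have e : (inner ℝ (fwdAvg h g t) (wh h t) - inner ℝ (g t) (w t) : ℝ) =
        inner ℝ (fwdAvg h g t - g t) (wh h t) + inner ℝ (g t) (wh h t - w t) := by
      rw [inner_sub_left, inner_sub_right]; ring
    have hd := le_min_iff.1 (h1 t ht')
    have hn : ‖wh h t‖ ≤ |M| + 1 := by
      have := norm_add_le (w t) (wh h t - w t)
      rw [add_sub_cancel] at this
      linarith [hM t ht', le_abs_self M]
    rw [e]
    refine (norm_add_le _ _).trans (add_le_add ?_ ?_)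
    · refine (norm_inner_le_norm _ _).trans ?_
      rw [mul_comm]
      gcongr
    · refine (norm_inner_le_norm _ _).trans ?_
      rw [mul_comm]
      gcongr
      exact hd.2
  rw [intervalIntegral.integral_add (hI.const_mul _) ((hg a b).norm.const_mul _),
    intervalIntegral.integral_const_mul, intervalIntegral.integral_const_mul] at key
  have : ε / (2 * (G + 1)) * G < ε / 2 := by
    rw [div_mul_eq_mul_div, div_lt_div_iff₀ (by positivity) (by norm_num)]
    nlinarith
  linarith

end Inner

theorem inner_fwdAvg {X : Type*} [NormedAddCommGroup X] [InnerProductSpace ℝ X] [CompleteSpace X]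
    {g : ℝ → X} (hg : ∀ a b, IntervalIntegrable g volume a b) (h t : ℝ) (c : X) :
    inner ℝ (fwdAvg h g t) c = h⁻¹ * ∫ s in t..t + h, inner ℝ (g s) c := by
  rw [fwdAvg, real_inner_smul_left, real_inner_comm]
  congr 1
  have := ((innerSL ℝ c).intervalIntegral_comp_comm (hg t (t + h))).symm
  simp only [innerSL_apply_apply] at this
  rw [this]
  simp_rw [real_inner_comm]

theorem tendsto_fwdAvg {X : Type*} [NormedAddCommGroup X] [NormedSpace ℝ X] [CompleteSpace X]
    {g : ℝ → X} (hg : Continuous g) (t : ℝ) :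
    Tendsto (fun h => fwdAvg h g t) (𝓝[>] 0) (𝓝 (g t)) := by
  rw [tendsto_iff_norm_sub_tendsto_zero, Metric.tendsto_nhds]
  intro ε hε
  filter_upwards [eventually_norm_fwdAvg_sub_le hg t t (half_pos hε)] with h hh
  have := hh t (by simp)
  rw [Real.dist_eq, sub_zero, abs_of_nonneg (norm_nonneg _)]
  linarith

/-! ### Energy and pairing identities for abstract damped wave equations. -/

section WeakFlow

variable {H W : Type*} [NormedAddCommGroup H] [InnerProductSpace ℝ H]
  [NormedAddCommGroup W] [InnerProductSpace ℝ W]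

/-- `(u, v)` solves `u'' + 2 α u' + A u = g` for positive times, where `A` is the operator of the
form given by the inner product of `W`, tested against the subspace `V` of `W`. -/
structure WeakFlow (α : ℝ) (ι : W →L[ℝ] H) (V : Submodule ℝ W) (u : ℝ → W) (v g : ℝ → H) :
    Prop where
  mem : ∀ t, u t ∈ V
  cont_u : Continuous u
  cont_v : Continuous v
  int_g : ∀ a b, IntervalIntegrable g volume a b
  deriv : ∀ t, 0 < t → HasDerivAt (fun s => ι (u s)) (v t) t
  eqn : ∀ φ ∈ V, ∀ s t, 0 ≤ s → s ≤ t → inner ℝ (v t) (ι φ) - inner ℝ (v s) (ι φ) =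
    ∫ r in s..t, (-(2 * α * inner ℝ (v r) (ι φ)) - inner ℝ (u r) φ + inner ℝ (g r) (ι φ))

variable {α : ℝ} {ι : W →L[ℝ] H} {V : Submodule ℝ W}
  {u : ℝ → W} {v g : ℝ → H}

namespace WeakFlow

theorem int_u (hw : WeakFlow α ι V u v g) (a b : ℝ) : IntervalIntegrable u volume a b :=
  hw.cont_u.intervalIntegrable a b

theorem int_v (hw : WeakFlow α ι V u v g) (a b : ℝ) : IntervalIntegrable v volume a b :=
  hw.cont_v.intervalIntegrable a b

variable [CompleteSpace H]

/-- This is what makes the averaged velocity an admissible test function: it is the image of a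
difference quotient of `u`, which lies in `V`. -/
theorem map_diffQuot (hw : WeakFlow α ι V u v g) {h t : ℝ} (hh : 0 < h) (ht : 0 < t) :
    ι (h⁻¹ • (u (t + h) - u t)) = fwdAvg h v t := by
  rw [fwdAvg, intervalIntegral.integral_eq_sub_of_hasDerivAt (f := fun s => ι (u s))
    (fun x hx => hw.deriv x ?_) (hw.int_v _ _)]
  · simp
  · rw [uIcc_of_le (by linarith)] at hx
    linarith [hx.1]

variable [CompleteSpace W]

theorem inner_diffQuot (hw : WeakFlow α ι V u v g) {φ : W} (hφ : φ ∈ V) {h t : ℝ} (hh : 0 < h)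
    (ht : 0 ≤ t) : inner ℝ (h⁻¹ • (v (t + h) - v t)) (ι φ) =
      -(2 * α * inner ℝ (fwdAvg h v t) (ι φ)) - inner ℝ (fwdAvg h u t) φ
        + inner ℝ (fwdAvg h g t) (ι φ) := by
  rw [real_inner_smul_left, inner_sub_left, hw.eqn φ hφ t (t + h) ht (by linarith),
    inner_fwdAvg hw.int_v, inner_fwdAvg hw.int_u, inner_fwdAvg hw.int_g]
  have i1 : IntervalIntegrable (fun r => inner ℝ (v r) (ι φ)) volume t (t + h) :=
    intervalIntegrable_inner (hw.int_v _ _) continuous_const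
  have i2 : IntervalIntegrable (fun r => inner ℝ (u r) φ) volume t (t + h) :=
    intervalIntegrable_inner (hw.int_u _ _) continuous_const
  have i3 : IntervalIntegrable (fun r => inner ℝ (g r) (ι φ)) volume t (t + h) :=
    intervalIntegrable_inner (hw.int_g _ _) continuous_const
  have i1' : IntervalIntegrable (fun r => -(2 * α * inner ℝ (v r) (ι φ))) volume t (t + h) :=
    (i1.const_mul _).neg
  rw [intervalIntegral.integral_add (i1'.sub i2) i3,
    intervalIntegral.integral_sub i1' i2, intervalIntegral.integral_neg,
    intervalIntegral.integral_const_mul]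
  ring

/-- The averaged equation is tested against the difference quotient of `u`. In `W` this quotient is
the derivative of the averaged `u`, so the form term cancels the derivative of `‖fwdAvg h u‖ ^ 2`.
-/
theorem energy_fwdAvg (hw : WeakFlow α ι V u v g) {a b h : ℝ} (hh : 0 < h) (ha : 0 < a)
    (hab : a ≤ b) :
    (‖fwdAvg h v b‖ ^ 2 + ‖fwdAvg h u b‖ ^ 2) - (‖fwdAvg h v a‖ ^ 2 + ‖fwdAvg h u a‖ ^ 2) =
      2 * (-(2 * α) * (∫ t in a..b, inner ℝ (fwdAvg h v t) (fwdAvg h v t))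
        + ∫ t in a..b, inner ℝ (fwdAvg h g t) (fwdAvg h v t)) := by
  have cv := continuous_fwdAvg hw.int_v h
  have cg := continuous_fwdAvg hw.int_g h
  have i1 : IntervalIntegrable (fun t => inner ℝ (fwdAvg h v t) (fwdAvg h v t)) volume a b :=
    intervalIntegrable_inner (cv.intervalIntegrable _ _) cv
  have i2 : IntervalIntegrable (fun t => inner ℝ (fwdAvg h g t) (fwdAvg h v t)) volume a b :=
    intervalIntegrable_inner (cg.intervalIntegrable _ _) cv
  rw [← intervalIntegral.integral_const_mul (-(2 * α)),
    ← intervalIntegral.integral_add (i1.const_mul _) i2, ← intervalIntegral.integral_const_mul]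
  symm
  refine intervalIntegral.integral_eq_sub_of_hasDerivAt
    (f := fun t => ‖fwdAvg h v t‖ ^ 2 + ‖fwdAvg h u t‖ ^ 2) (fun t ht => ?_)
    (((i1.const_mul _).add i2).const_mul _)
  rw [uIcc_of_le hab] at ht
  have ht0 : 0 < t := ha.trans_le ht.1
  have h1 := (hasDerivAt_fwdAvg hw.cont_v h t).norm_sq
  have h2 := (hasDerivAt_fwdAvg hw.cont_u h t).norm_sq
  have hm : h⁻¹ • (u (t + h) - u t) ∈ V := V.smul_mem _ (V.sub_mem (hw.mem _) (hw.mem _))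
  have h3 := hw.inner_diffQuot hm hh ht0.le
  rw [hw.map_diffQuot hh ht0] at h3
  refine (h1.add h2).congr_deriv ?_
  rw [real_inner_comm (h⁻¹ • (v (t + h) - v t)) (fwdAvg h v t), h3]
  ring

/-- Here `u t` itself is admissible and `ι (u t)` is already differentiable, so only the velocity
needs averaging. -/
theorem pairing_fwdAvg (hw : WeakFlow α ι V u v g) {a b h : ℝ} (hh : 0 < h) (ha : 0 < a)
    (hab : a ≤ b) :
    inner ℝ (fwdAvg h v b) (ι (u b)) - inner ℝ (fwdAvg h v a) (ι (u a)) =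
      (∫ t in a..b, inner ℝ (fwdAvg h v t) (v t))
        - 2 * α * (∫ t in a..b, inner ℝ (fwdAvg h v t) (ι (u t)))
        - (∫ t in a..b, inner ℝ (fwdAvg h u t) (u t))
        + ∫ t in a..b, inner ℝ (fwdAvg h g t) (ι (u t)) := by
  have cv := continuous_fwdAvg hw.int_v h
  have cu := continuous_fwdAvg hw.int_u h
  have cg := continuous_fwdAvg hw.int_g h
  have cι : Continuous fun t => ι (u t) := ι.continuous.comp hw.cont_u
  have i1 : IntervalIntegrable (fun t => inner ℝ (fwdAvg h v t) (v t)) volume a b :=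
    intervalIntegrable_inner (cv.intervalIntegrable _ _) hw.cont_v
  have i2 : IntervalIntegrable (fun t => inner ℝ (fwdAvg h v t) (ι (u t))) volume a b :=
    intervalIntegrable_inner (cv.intervalIntegrable _ _) cι
  have i3 : IntervalIntegrable (fun t => inner ℝ (fwdAvg h u t) (u t)) volume a b :=
    intervalIntegrable_inner (cu.intervalIntegrable _ _) hw.cont_u
  have i4 : IntervalIntegrable (fun t => inner ℝ (fwdAvg h g t) (ι (u t))) volume a b :=
    intervalIntegrable_inner (cg.intervalIntegrable _ _) cι
  rw [← intervalIntegral.integral_const_mul, ← intervalIntegral.integral_sub i1 (i2.const_mul _),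
    ← intervalIntegral.integral_sub (i1.sub (i2.const_mul _)) i3,
    ← intervalIntegral.integral_add ((i1.sub (i2.const_mul _)).sub i3) i4]
  symm
  refine intervalIntegral.integral_eq_sub_of_hasDerivAt
    (f := fun t => inner ℝ (fwdAvg h v t) (ι (u t))) (fun t ht => ?_)
    (((i1.sub (i2.const_mul _)).sub i3).add i4)
  rw [uIcc_of_le hab] at ht
  have ht0 : 0 < t := ha.trans_le ht.1
  refine ((hasDerivAt_fwdAvg hw.cont_v h t).inner ℝ (hw.deriv t ht0)).congr_deriv ?_
  rw [hw.inner_diffQuot (hw.mem t) hh ht0.le]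
  ring

/-- The energy identity. -/
theorem energy_eq (hw : WeakFlow α ι V u v g) {a b : ℝ} (ha : 0 < a) (hab : a ≤ b) :
    (‖v b‖ ^ 2 + ‖u b‖ ^ 2) - (‖v a‖ ^ 2 + ‖u a‖ ^ 2) =
      2 * (-(2 * α) * (∫ t in a..b, ‖v t‖ ^ 2) + ∫ t in a..b, inner ℝ (g t) (v t)) := by
  have cv := continuous_fwdAvg hw.int_v
  have hL : Tendsto (fun h => (‖fwdAvg h v b‖ ^ 2 + ‖fwdAvg h u b‖ ^ 2)
      - (‖fwdAvg h v a‖ ^ 2 + ‖fwdAvg h u a‖ ^ 2)) (𝓝[>] 0)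
      (𝓝 ((‖v b‖ ^ 2 + ‖u b‖ ^ 2) - (‖v a‖ ^ 2 + ‖u a‖ ^ 2))) :=
    (((tendsto_fwdAvg hw.cont_v b).norm.pow 2).add ((tendsto_fwdAvg hw.cont_u b).norm.pow 2)).sub
      (((tendsto_fwdAvg hw.cont_v a).norm.pow 2).add ((tendsto_fwdAvg hw.cont_u a).norm.pow 2))
  have hv := fun ε (hε : (0 : ℝ) < ε) => eventually_norm_fwdAvg_sub_le hw.cont_v a b hε
  have hR := (((tendsto_integral_inner_fwdAvg hw.int_v hab hw.cont_v cv hv).const_mul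
    (-(2 * α))).add (tendsto_integral_inner_fwdAvg hw.int_g hab hw.cont_v cv hv)).const_mul 2
  simp_rw [← real_inner_self_eq_norm_sq (v _)] at hL ⊢
  refine tendsto_nhds_unique (hL.congr' ?_) hR
  filter_upwards [self_mem_nhdsWithin] with h hh
  have := hw.energy_fwdAvg (mem_Ioi.1 hh) ha hab
  simpa only [real_inner_self_eq_norm_sq] using this

/-- The identity for the time derivative of `⟨u', u⟩`. -/
theorem pairing_eq (hw : WeakFlow α ι V u v g) {a b : ℝ} (ha : 0 < a) (hab : a ≤ b) :
    inner ℝ (v b) (ι (u b)) - inner ℝ (v a) (ι (u a)) =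
      (∫ t in a..b, ‖v t‖ ^ 2) - 2 * α * (∫ t in a..b, inner ℝ (v t) (ι (u t)))
        - (∫ t in a..b, ‖u t‖ ^ 2) + ∫ t in a..b, inner ℝ (g t) (ι (u t)) := by
  have cι : Continuous fun t => ι (u t) := ι.continuous.comp hw.cont_u
  have hL : Tendsto (fun h => (inner ℝ (fwdAvg h v b) (ι (u b)) -
      inner ℝ (fwdAvg h v a) (ι (u a)) : ℝ)) (𝓝[>] 0)
      (𝓝 (inner ℝ (v b) (ι (u b)) - inner ℝ (v a) (ι (u a)))) :=
    ((tendsto_fwdAvg hw.cont_v b).inner tendsto_const_nhds).sub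
      ((tendsto_fwdAvg hw.cont_v a).inner tendsto_const_nhds)
  have t1 := tendsto_integral_inner_fwdAvg hw.int_v hab hw.cont_v (fun _ => hw.cont_v) (by simp +contextual [le_of_lt])
  have t2 := tendsto_integral_inner_fwdAvg hw.int_v hab cι (fun _ => cι) (by simp +contextual [le_of_lt])
  have t3 := tendsto_integral_inner_fwdAvg hw.int_u hab hw.cont_u (fun _ => hw.cont_u) (by simp +contextual [le_of_lt])
  have t4 := tendsto_integral_inner_fwdAvg hw.int_g hab cι (fun _ => cι) (by simp +contextual [le_of_lt])
  have hR := ((t1.sub (t2.const_mul (2 * α))).sub t3).add t4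
  simp_rw [← real_inner_self_eq_norm_sq]
  refine tendsto_nhds_unique (hL.congr' ?_) hR
  filter_upwards [self_mem_nhdsWithin] with h hh
  exact hw.pairing_fwdAvg (mem_Ioi.1 hh) ha hab

end WeakFlow
end WeakFlow

/-! ### Ordinary differential inequalities for the concavity method. -/

section Levine

/-- A positive function with `Φ Φ'' ≥ (1 + κ) Φ'^2`, in integrated form, and `Φ' > 0` somewhere
cannot be global. -/
theorem false_of_concavity {Φ D m : ℝ → ℝ} {κ a : ℝ} (hκ : 0 < κ)
    (hΦ : ∀ t, a ≤ t → HasDerivAt Φ (D t) t) (hpos : ∀ t, a ≤ t → 0 < Φ t) (hm : Continuous m)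
    (hD : ∀ t, a ≤ t → D a + ∫ s in a..t, m s ≤ D t) (hDa : 0 < D a)
    (hc : ∀ t, a ≤ t → (1 + κ) * D t ^ 2 ≤ m t * Φ t) : False := by
  have hm0 : ∀ t, a ≤ t → 0 ≤ m t := fun t ht =>
    nonneg_of_mul_nonneg_left ((by positivity : 0 ≤ (1 + κ) * D t ^ 2).trans (hc t ht)) (hpos t ht)
  -- `D` need not be differentiable, so its `C¹` minorant `B` replaces it; the goal is that `B Φ ^
  -- (-(1 + κ))` is nondecreasing.
  set B : ℝ → ℝ := fun t => D a + ∫ s in a..t, m s with hB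
  have hBd : ∀ t, HasDerivAt B (m t) t := fun t =>
    ((hm.integral_hasStrictDerivAt a t).hasDerivAt).const_add _
  have hBpos : ∀ t, a ≤ t → D a ≤ B t := fun t ht => by
    have := intervalIntegral.integral_nonneg (μ := volume) ht (fun s hs => hm0 s hs.1)
    simp only [hB]; linarith
  have key : ∀ t, a ≤ t → B a * Φ a ^ (-(1 + κ)) ≤ B t * Φ t ^ (-(1 + κ)) := by
    have hmono : MonotoneOn (fun t => B t * Φ t ^ (-(1 + κ))) (Ici a) := by
      have hd : ∀ t, a ≤ t → HasDerivAt (fun t => B t * Φ t ^ (-(1 + κ)))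
          (m t * Φ t ^ (-(1 + κ)) + B t * (D t * (-(1 + κ)) * Φ t ^ (-(1 + κ) - 1))) t :=
        fun t ht => (hBd t).mul ((hΦ t ht).rpow_const (Or.inl (hpos t ht).ne'))
      refine monotoneOn_of_deriv_nonneg (convex_Ici a)
        (fun t ht => (hd t ht).continuousAt.continuousWithinAt)
        (fun t ht => (hd t (interior_subset ht)).differentiableAt.differentiableWithinAt)
        fun t ht => ?_
      have ht' : a ≤ t := interior_subset ht
      rw [(hd t ht').deriv]
      have hp := hpos t ht'
      have e : Φ t ^ (-(1 + κ)) = Φ t * Φ t ^ (-(1 + κ) - 1) := by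
        rw [← Real.rpow_one_add' hp.le (by linarith)]; congr 1; ring
      rw [e]
      have h1 : B t * D t ≤ D t ^ 2 := by
        have := hD t ht'
        have := hBpos t ht'
        nlinarith
      have h2 := hc t ht'
      have h3 : 0 ≤ m t * Φ t - (1 + κ) * (B t * D t) := by nlinarith
      have := mul_nonneg h3 (Real.rpow_nonneg hp.le (-(1 + κ) - 1))
      linarith
    intro t ht
    exact hmono (mem_Ici.2 le_rfl) ht ht
  set c := B a * Φ a ^ (-(1 + κ)) with hcdef
  have hcpos : 0 < c := by
    have : B a = D a := by simp [hB]
    rw [hcdef, this]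
    exact mul_pos hDa (Real.rpow_pos_of_pos (hpos a le_rfl) _)
  have hanti : AntitoneOn (fun t => Φ t ^ (-κ) + κ * c * t) (Ici a) := by
    have hd : ∀ t, a ≤ t → HasDerivAt (fun t => Φ t ^ (-κ) + κ * c * t)
        (D t * (-κ) * Φ t ^ (-κ - 1) + κ * c) t := fun t ht => by
      have := ((hΦ t ht).rpow_const (p := -κ) (Or.inl (hpos t ht).ne')).add
        ((hasDerivAt_id t).const_mul (κ * c))
      exact this.congr_deriv (by ring)
    refine antitoneOn_of_deriv_nonpos (convex_Ici a)
      (fun t ht => (hd t ht).continuousAt.continuousWithinAt)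
      (fun t ht => (hd t (interior_subset ht)).differentiableAt.differentiableWithinAt)
      fun t ht => ?_
    have ht' : a ≤ t := interior_subset ht
    rw [(hd t ht').deriv]
    have h1 : c ≤ D t * Φ t ^ (-(1 + κ)) := (key t ht').trans
      (mul_le_mul_of_nonneg_right (hD t ht') (Real.rpow_nonneg (hpos t ht').le _))
    have e : -κ - 1 = -(1 + κ) := by ring
    rw [e]
    nlinarith
  -- At this time the nonincreasing quantity `Φ ^ (-κ) + κ c t` forces `Φ T ^ (-κ) ≤ 0`.
  set T := a + (Φ a ^ (-κ)) / (κ * c) with hT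
  have hTa : a ≤ T := by
    have := Real.rpow_nonneg (hpos a le_rfl).le (-κ)
    rw [hT]; have : 0 ≤ (Φ a ^ (-κ)) / (κ * c) := by positivity
    linarith
  have h1 := hanti (mem_Ici.2 le_rfl) (mem_Ici.2 hTa) hTa
  have h2 := Real.rpow_pos_of_pos (hpos T hTa) (-κ)
  have h3 : κ * c * T = κ * c * a + Φ a ^ (-κ) := by
    rw [hT, mul_add, mul_div_cancel₀]; positivity
  simp only at h1
  linarith

/-- If `y' + 2 α y` tends to infinity with `α ≥ 0`, then so does `y`. -/
theorem eventually_ge_of_damped {y P : ℝ → ℝ} {α a : ℝ} (hα : 0 ≤ α) (ha : 0 ≤ a)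
    (hy : ∀ t, a ≤ t → HasDerivAt y (P t) t)
    (h : Tendsto (fun t => P t + 2 * α * y t) atTop atTop) (K : ℝ) : ∀ᶠ t in atTop, K ≤ y t := by
  -- With this threshold `exp (2αt) (y - K)` has derivative at least `exp (2αt) ≥ 1`, so it grows at
  -- least like `t`.
  obtain ⟨b, hb⟩ := eventually_atTop.1 (h.eventually_ge_atTop (2 * α * K + 1))
  set c := max a b
  have hd : ∀ t, c ≤ t → HasDerivAt (fun t => Real.exp (2 * α * t) * (y t - K) - t)
      (Real.exp (2 * α * t) * (2 * α) * (y t - K) + Real.exp (2 * α * t) * P t - 1) t :=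
    fun t ht => by
      have h1 : HasDerivAt (fun t => Real.exp (2 * α * t)) (Real.exp (2 * α * t) * (2 * α)) t := by
        simpa using ((hasDerivAt_id t).const_mul (2 * α)).exp
      exact (h1.mul ((hy t ((le_max_left _ _).trans ht)).sub_const K)).sub (hasDerivAt_id t)
  have hmono : MonotoneOn (fun t => Real.exp (2 * α * t) * (y t - K) - t) (Ici c) := by
    refine monotoneOn_of_deriv_nonneg (convex_Ici c)
      (fun t ht => (hd t ht).continuousAt.continuousWithinAt)
      (fun t ht => (hd t (interior_subset ht)).differentiableAt.differentiableWithinAt)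
      fun t ht => ?_
    have ht' : c ≤ t := interior_subset ht
    rw [(hd t ht').deriv]
    have h1 := hb t ((le_max_right _ _).trans ht')
    have h2 : 1 ≤ Real.exp (2 * α * t) := by
      have : 0 ≤ t := ha.trans ((le_max_left _ _).trans ht')
      exact Real.one_le_exp (by positivity)
    nlinarith
  set E := Real.exp (2 * α * c) * (y c - K) - c
  filter_upwards [eventually_ge_atTop c, eventually_ge_atTop (-E)] with t h1 h2
  have h3 := hmono (mem_Ici.2 le_rfl) (mem_Ici.2 h1) h1
  simp only at h3
  have h4 : 0 ≤ Real.exp (2 * α * t) * (y t - K) := by linarith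
  have := nonneg_of_mul_nonneg_right h4 (Real.exp_pos _)
  linarith

end Levine

/-! ### Approximation of `H¹` functions by compactly supported `C¹` functions. -/

section Mollify

theorem eLpNorm_two_eq {X E : Type*} [MeasurableSpace X] [NormedAddCommGroup E] (f : X → E)
    (μ : Measure X) : eLpNorm f 2 μ = (∫⁻ x, ‖f x‖ₑ ^ (2 : ℝ) ∂μ) ^ (1 / 2 : ℝ) := by
  rw [eLpNorm_eq_lintegral_rpow_enorm_toReal (by norm_num) (by norm_num)]
  simp

/-- Jensen's inequality for the probability density `R`, from Cauchy–Schwarz with the splitting `R K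
= R^(1/2) · R^(1/2) K`. -/
theorem lintegral_mul_sq_le {X : Type*} [MeasurableSpace X] {μ : Measure X} {R K : X → ℝ≥0∞}
    (hR : AEMeasurable R μ) (hK : AEMeasurable K μ) (h1 : ∫⁻ x, R x ∂μ = 1) :
    (∫⁻ x, R x * K x ∂μ) ^ (2 : ℝ) ≤ ∫⁻ x, R x * K x ^ (2 : ℝ) ∂μ := by
  have h := ENNReal.lintegral_mul_le_Lp_mul_Lq μ (p := 2) (q := 2) Real.HolderConjugate.two_two
    (f := fun x => R x ^ (1 / 2 : ℝ)) (g := fun x => R x ^ (1 / 2 : ℝ) * K x)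
    (hR.pow_const _) ((hR.pow_const _).mul hK)
  have e1 : ∀ r : ℝ≥0∞, (r ^ (1 / 2 : ℝ)) ^ (2 : ℝ) = r := fun r => by
    rw [← ENNReal.rpow_mul]; norm_num
  have e2 : ∀ r : ℝ≥0∞, r ^ (1 / 2 : ℝ) * r ^ (1 / 2 : ℝ) = r := fun r => by
    rw [← ENNReal.rpow_add_of_nonneg _ _ (by norm_num) (by norm_num)]; norm_num
  simp only [Pi.mul_apply, ← mul_assoc, e2, e1, h1, ENNReal.mul_rpow_of_nonneg _ _
    (zero_le_two : (0 : ℝ) ≤ 2), ENNReal.one_rpow, one_mul] at h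
  calc _ ≤ _ := ENNReal.rpow_le_rpow h zero_le_two
    _ = _ := e1 _

variable {d : ℕ}

/-- Young's inequality for a kernel of unit mass: Jensen in the convolution variable, then Tonelli
and translation invariance. -/
theorem eLpNorm_convolution_le {ρ w : Space d → ℝ} (hρ : Continuous ρ)
    (hρi : ∫⁻ x, ‖ρ x‖ₑ = 1) (hw : StronglyMeasurable w) :
    eLpNorm (ρ ⋆[ContinuousLinearMap.lsmul ℝ ℝ, volume] w) 2 volume ≤ eLpNorm w 2 volume := by
  rw [eLpNorm_two_eq, eLpNorm_two_eq]
  refine ENNReal.rpow_le_rpow ?_ (by norm_num)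
  have hρm : Measurable fun x => ‖ρ x‖ₑ := hρ.measurable.enorm
  have hwm : Measurable fun x => ‖w x‖ₑ := hw.measurable.enorm
  calc ∫⁻ x, ‖(ρ ⋆[ContinuousLinearMap.lsmul ℝ ℝ, volume] w) x‖ₑ ^ (2 : ℝ)
      ≤ ∫⁻ x, ∫⁻ y, ‖ρ y‖ₑ * ‖w (x - y)‖ₑ ^ (2 : ℝ) := by
        refine lintegral_mono fun x => ?_
        refine le_trans (ENNReal.rpow_le_rpow ?_ zero_le_two) (lintegral_mul_sq_le
          hρm.aemeasurable (K := fun y => ‖w (x - y)‖ₑ)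
          (hwm.comp (measurable_const.sub measurable_id)).aemeasurable hρi)
        rw [convolution_lsmul]
        refine (enorm_integral_le_lintegral_enorm _).trans (le_of_eq ?_)
        simp
    _ = ∫⁻ y, ∫⁻ x, ‖ρ y‖ₑ * ‖w (x - y)‖ₑ ^ (2 : ℝ) := by
        refine lintegral_lintegral_swap ?_
        refine Measurable.aemeasurable ?_
        exact (hρm.comp measurable_snd).mul
          ((hwm.comp (measurable_fst.sub measurable_snd)).pow_const _)
    _ = ∫⁻ y, ‖ρ y‖ₑ * ∫⁻ x, ‖w x‖ₑ ^ (2 : ℝ) := by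
        refine lintegral_congr fun y => ?_
        rw [lintegral_const_mul' _ _ enorm_ne_top,
          lintegral_sub_right_eq_self (fun x => ‖w x‖ₑ ^ (2 : ℝ)) y]
    _ = ∫⁻ x, ‖w x‖ₑ ^ (2 : ℝ) := by
        rw [lintegral_mul_const _ hρm, hρi, one_mul]

/-- The weak gradient is tested on `y ↦ ρ (x - y)`; the sign from the reflection cancels the sign
from integration by parts. -/
theorem fderiv_convolution_apply {ρ : Space d → ℝ} (hρ : ContDiff ℝ ∞ ρ)
    (hc : HasCompactSupport ρ) {u : L2 d} {G : L2Field d} (hG : IsWeakGradient u G)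
    (x : Space d) (i : Fin d) :
    fderiv ℝ (ρ ⋆[ContinuousLinearMap.lsmul ℝ ℝ, volume] u) x (EuclideanSpace.single i 1) =
      (ρ ⋆[ContinuousLinearMap.lsmul ℝ ℝ, volume] fun y => G y i) x := by
  have hloc : LocallyIntegrable u volume := (Lp.memLp u).locallyIntegrable (by norm_num)
  have h1 : ContDiff ℝ 1 ρ := hρ.of_le (by simp)
  rw [(hc.hasFDerivAt_convolution_left (ContinuousLinearMap.lsmul ℝ ℝ) h1 hloc x).fderiv]
  have hex := (hc.fderiv ℝ).convolutionExists_left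
    ((ContinuousLinearMap.lsmul ℝ ℝ : ℝ →L[ℝ] ℝ →L[ℝ] ℝ).precompL (Space d))
    (h1.continuous_fderiv one_ne_zero) hloc x
  rw [convolution_def, ContinuousLinearMap.integral_apply hex]
  simp only [ContinuousLinearMap.precompL_apply, ContinuousLinearMap.lsmul_apply, smul_eq_mul]
  rw [convolution_lsmul_swap]
  rw [← integral_sub_left_eq_self _ volume x]
  simp only [sub_sub_cancel, smul_eq_mul]
  set φ : Space d → ℝ := fun y => ρ (x - y) with hφ
  have hφs : ContDiff ℝ ∞ φ := hρ.comp (contDiff_const.sub contDiff_id)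
  have hφc : HasCompactSupport φ := hc.comp_homeomorph (Homeomorph.subLeft x)
  have hφd : ∀ y, fderiv ℝ φ y = - fderiv ℝ ρ (x - y) := fun y => by
    have := (h1.differentiable one_ne_zero (x - y)).hasFDerivAt.comp y
      ((hasFDerivAt_id y).const_sub x)
    have := this.fderiv
    simp only [ContinuousLinearMap.comp_neg, ContinuousLinearMap.comp_id] at this
    exact this
  have := hG φ hφs hφc i
  simp only [hφd, neg_apply, mul_neg, integral_neg, neg_inj] at this
  simp_rw [mul_comm] at this ⊢
  exact this

theorem opNorm_le_sum_single (L : Space d →L[ℝ] ℝ) :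
    ‖L‖ ≤ ∑ i, ‖L (EuclideanSpace.single i 1)‖ := by
  refine L.opNorm_le_bound (Finset.sum_nonneg fun i _ => norm_nonneg _) fun x => ?_
  have hx : x = ∑ i, x i • (EuclideanSpace.single i (1 : ℝ) : Space d) := by
    ext j
    simp [Pi.single_apply]
  conv_lhs => rw [hx, map_sum]
  refine (norm_sum_le _ _).trans ?_
  rw [Finset.sum_mul]
  refine Finset.sum_le_sum fun i _ => ?_
  rw [map_smul, norm_smul, mul_comm]
  gcongr
  exact PiLp.norm_apply_le x i

/-- Mollification: elements of `H¹` are almost everywhere limits of smooth functions bounded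
in `H¹`. -/
theorem exists_mollified (u : H1 d) : ∃ (w : ℕ → Space d → ℝ) (A : ℝ≥0∞), A ≠ ⊤ ∧
    (∀ n, ContDiff ℝ 1 (w n) ∧ eLpNorm (w n) 2 volume ≤ A ∧
      eLpNorm (fderiv ℝ (w n)) 2 volume ≤ A) ∧
    ∀ᵐ x, Tendsto (fun n => w n x) atTop (𝓝 (u.fn x)) := by
  have hG : IsWeakGradient u.fn u.grad := u.2
  -- The ratio of outer to inner radius stays equal to `2`, as the Lebesgue differentiation theorem
  -- for bump functions requires it to be bounded.
  let ρ : ℕ → ContDiffBump (0 : Space d) := fun n =>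
    ⟨1 / (n + 1), 2 / (n + 1), by positivity, by gcongr; norm_num⟩
  have hρ0 : ∀ n, ∫⁻ x, ‖(ρ n).normed volume x‖ₑ = 1 := fun n => by
    have h := (ρ n).integral_normed (μ := volume)
    rw [integral_eq_lintegral_of_nonneg_ae (Eventually.of_forall fun x => (ρ n).nonneg_normed x)
      (ρ n).continuous_normed.aestronglyMeasurable] at h
    have : ∀ x, ‖(ρ n).normed volume x‖ₑ = ENNReal.ofReal ((ρ n).normed volume x) :=
      fun x => Real.enorm_of_nonneg ((ρ n).nonneg_normed x)
    simp_rw [this]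
    rwa [ENNReal.toReal_eq_one_iff] at h
  have hloc : LocallyIntegrable u.fn volume := (Lp.memLp u.fn).locallyIntegrable (by norm_num)
  set w : ℕ → Space d → ℝ := fun n =>
    (ρ n).normed volume ⋆[ContinuousLinearMap.lsmul ℝ ℝ, volume] u.fn with hw
  have hws : ∀ n, ContDiff ℝ 1 (w n) := fun n =>
    (ρ n).hasCompactSupport_normed.contDiff_convolution_left (n := 1) _
      (ρ n).contDiff_normed hloc
  have hwn : ∀ n, eLpNorm (w n) 2 volume ≤ eLpNorm u.fn 2 volume := fun n =>
    eLpNorm_convolution_le (ρ n).continuous_normed (hρ0 n) (Lp.stronglyMeasurable _)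
  set B := ∑ i : Fin d, eLpNorm (fun y => u.grad y i) 2 volume with hB
  have hBt : B ≠ ⊤ := by
    refine ENNReal.sum_ne_top.2 fun i _ => ?_
    exact ((EuclideanSpace.proj (𝕜 := ℝ) i).comp_memLp' (Lp.memLp u.grad)).eLpNorm_ne_top
  have hwd : ∀ n, eLpNorm (fderiv ℝ (w n)) 2 volume ≤ B := fun n => by
    have hcd : ∀ i : Fin d, Continuous fun x => fderiv ℝ (w n) x (EuclideanSpace.single i 1) :=
      fun i => ((hws n).continuous_fderiv one_ne_zero).clm_apply continuous_const
    calc eLpNorm (fderiv ℝ (w n)) 2 volume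
        ≤ eLpNorm (∑ i, fun x => ‖fderiv ℝ (w n) x (EuclideanSpace.single i 1)‖) 2 volume := by
          refine eLpNorm_mono_real fun x => ?_
          rw [Finset.sum_apply]
          exact opNorm_le_sum_single _
      _ ≤ ∑ i, eLpNorm (fun x => ‖fderiv ℝ (w n) x (EuclideanSpace.single i 1)‖) 2 volume :=
          eLpNorm_sum_le (fun i _ => (hcd i).norm.aestronglyMeasurable) (by norm_num)
      _ ≤ B := by
          refine Finset.sum_le_sum fun i _ => ?_
          rw [eLpNorm_norm]
          have : (fun x => fderiv ℝ (w n) x (EuclideanSpace.single i 1)) =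
              (ρ n).normed volume ⋆[ContinuousLinearMap.lsmul ℝ ℝ, volume]
                fun y => u.grad y i := funext fun x =>
            fderiv_convolution_apply (ρ n).contDiff_normed (ρ n).hasCompactSupport_normed hG x i
          rw [this]
          exact eLpNorm_convolution_le (ρ n).continuous_normed (hρ0 n)
            ((EuclideanSpace.proj (𝕜 := ℝ) i).continuous.comp_stronglyMeasurable
              (Lp.stronglyMeasurable u.grad))
  refine ⟨w, eLpNorm u.fn 2 volume + B, ENNReal.add_ne_top.2 ⟨Lp.eLpNorm_ne_top _, hBt⟩,
    fun n => ⟨hws n, (hwn n).trans (le_add_right le_rfl), (hwd n).trans (le_add_left le_rfl)⟩, ?_⟩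
  refine ContDiffBump.ae_convolution_tendsto_right_of_locallyIntegrable (μ := volume)
    (φ := ρ) (l := atTop) (K := 2) (g := u.fn) ?_ ?_ hloc
  · change Tendsto (fun n : ℕ => (2 : ℝ) / (n + 1)) atTop (𝓝 0)
    exact tendsto_const_div_atTop_nhds_zero_nat 2 |>.comp (tendsto_add_atTop_nat 1) |>.congr
      fun n => by simp
  · refine Eventually.of_forall fun n => ?_
    change (2 : ℝ) / (n + 1) ≤ 2 * (1 / (n + 1))
    rw [mul_one_div]

/-- Cutoff functions with bounded gradients. -/
theorem exists_cutoff (d : ℕ) : ∃ (χ : ℕ → Space d → ℝ) (C : ℝ), 0 ≤ C ∧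
    (∀ n, ContDiff ℝ 1 (χ n) ∧ HasCompactSupport (χ n) ∧ (∀ x, ‖χ n x‖ ≤ 1) ∧
      ∀ x, ‖fderiv ℝ (χ n) x‖ ≤ C) ∧ ∀ x, ∀ᶠ n in atTop, χ n x = 1 := by
  let χ : ContDiffBump (0 : Space d) := ⟨1, 2, one_pos, one_lt_two⟩
  obtain ⟨C, hC⟩ := (χ.hasCompactSupport.fderiv ℝ).exists_bound_of_continuous
    ((χ.contDiff (n := 1)).continuous_fderiv one_ne_zero)
  refine ⟨fun n x => χ (((n : ℝ) + 1)⁻¹ • x), C, (norm_nonneg _).trans (hC 0), fun n =>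
    ⟨χ.contDiff.comp (contDiff_const_smul _), χ.hasCompactSupport.comp_homeomorph
      (Homeomorph.smulOfNeZero (((n : ℝ) + 1)⁻¹) (by positivity)), fun x => ?_, fun x => ?_⟩,
      fun x => ?_⟩
  · rw [Real.norm_of_nonneg χ.nonneg]; exact χ.le_one
  · have h1 : HasFDerivAt (fun x : Space d => ((n : ℝ) + 1)⁻¹ • x)
      (((n : ℝ) + 1)⁻¹ • ContinuousLinearMap.id ℝ (Space d)) x :=
      (((n : ℝ) + 1)⁻¹ • ContinuousLinearMap.id ℝ (Space d)).hasFDerivAt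
    have h2 := ((χ.contDiff (n := 1)).differentiable one_ne_zero
      (((n : ℝ) + 1)⁻¹ • x)).hasFDerivAt.comp x h1
    have h2' := h2.fderiv
    simp only [Function.comp_def] at h2'
    rw [h2', ContinuousLinearMap.comp_smul, ContinuousLinearMap.comp_id, norm_smul]
    have h3 : ‖((n : ℝ) + 1)⁻¹‖ ≤ 1 := by
      rw [Real.norm_of_nonneg (by positivity)]
      exact inv_le_one_of_one_le₀ (by linarith [n.cast_nonneg (α := ℝ)])
    exact (mul_le_of_le_one_left (norm_nonneg _) h3).trans (hC _)
  · filter_upwards [eventually_ge_atTop ⌈‖x‖⌉₊] with n hn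
    refine χ.one_of_mem_closedBall ?_
    rw [mem_closedBall_zero_iff, norm_smul, Real.norm_of_nonneg (by positivity)]
    have : ‖x‖ ≤ n := (Nat.le_ceil _).trans (by exact_mod_cast hn)
    change _ ≤ (1 : ℝ)
    rw [inv_mul_le_iff₀ (by positivity)]
    linarith

theorem eLpNorm_mul_cutoff_le {χ w : Space d → ℝ} (hχ : ∀ x, ‖χ x‖ ≤ 1) :
    eLpNorm (fun x => χ x * w x) 2 volume ≤ eLpNorm w 2 volume := by
  refine eLpNorm_mono fun x => ?_
  rw [norm_mul]
  exact mul_le_of_le_one_left (norm_nonneg _) (hχ x)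

theorem eLpNorm_fderiv_mul_cutoff_le {χ w : Space d → ℝ} (hχs : ContDiff ℝ 1 χ)
    (hw : ContDiff ℝ 1 w) {C : ℝ} (hχ : ∀ x, ‖χ x‖ ≤ 1) (hχd : ∀ x, ‖fderiv ℝ χ x‖ ≤ C) :
    eLpNorm (fderiv ℝ fun x => χ x * w x) 2 volume ≤
      eLpNorm (fderiv ℝ w) 2 volume + ENNReal.ofReal C * eLpNorm w 2 volume := by
  have hd : (fderiv ℝ fun x => χ x * w x) =
      (fun x => χ x • fderiv ℝ w x) + fun x => w x • fderiv ℝ χ x := funext fun x =>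
    fderiv_fun_mul (hχs.differentiable one_ne_zero x) (hw.differentiable one_ne_zero x)
  have c1 := hw.continuous_fderiv one_ne_zero
  have c2 := hχs.continuous_fderiv one_ne_zero
  rw [hd]
  refine (eLpNorm_add_le (hχs.continuous.smul c1).aestronglyMeasurable
    (hw.continuous.smul c2).aestronglyMeasurable (by norm_num)).trans (add_le_add ?_ ?_)
  · refine eLpNorm_mono fun x => ?_
    rw [Pi.smul_apply', norm_smul]
    exact mul_le_of_le_one_left (norm_nonneg _) (hχ x)
  · refine eLpNorm_le_mul_eLpNorm_of_ae_le_mul (Eventually.of_forall fun x => ?_) 2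
    rw [Pi.smul_apply', norm_smul, mul_comm]
    gcongr
    exact hχd x

/-- Elements of `H¹` are almost everywhere limits of test functions bounded in `H¹`. -/
theorem exists_test_approx (u : H1 d) : ∃ (φ : ℕ → Space d → ℝ) (A : ℝ≥0∞), A ≠ ⊤ ∧
    (∀ n, ContDiff ℝ 1 (φ n) ∧ HasCompactSupport (φ n) ∧ eLpNorm (φ n) 2 volume ≤ A ∧
      eLpNorm (fderiv ℝ (φ n)) 2 volume ≤ A) ∧
    ∀ᵐ x, Tendsto (fun n => φ n x) atTop (𝓝 (u.fn x)) := by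
  obtain ⟨w, A, hA, hw, hlim⟩ := exists_mollified u
  obtain ⟨χ, C, hC0, hχ, hχ1⟩ := exists_cutoff d
  refine ⟨fun n x => χ n x * w n x, A + ENNReal.ofReal C * A, ENNReal.add_ne_top.2
    ⟨hA, ENNReal.mul_ne_top ENNReal.ofReal_ne_top hA⟩, fun n => ?_, ?_⟩
  · obtain ⟨h1, h2, h3, h4⟩ := hχ n
    obtain ⟨k1, k2, k3⟩ := hw n
    refine ⟨h1.mul k1, h2.mul_right,
      (eLpNorm_mul_cutoff_le h3).trans (k2.trans (le_add_right le_rfl)),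
      (eLpNorm_fderiv_mul_cutoff_le h1 k1 h3 h4).trans ?_⟩
    gcongr
  · filter_upwards [hlim] with x hx
    refine hx.congr' ?_
    filter_upwards [hχ1 x] with n hn
    rw [hn, one_mul]

end Mollify

/-! ### The Sobolev embedding. -/

section Sobolev

variable {d : ℕ}

theorem eLpNorm_fderiv_pow_le {φ : Space d → ℝ} (hφ : ContDiff ℝ 1 φ) (k : ℕ) :
    eLpNorm (fderiv ℝ fun x => φ x ^ (k + 1)) 1 volume ≤
      (k + 1 : ℕ) * (eLpNorm (fun x => φ x ^ k) 2 volume * eLpNorm (fderiv ℝ φ) 2 volume) := by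
  have hd : ∀ x, ‖fderiv ℝ (fun x => φ x ^ (k + 1)) x‖ ≤
      ((k + 1 : ℕ) : ℝ) * ‖((fun x => φ x ^ k) • fderiv ℝ φ) x‖ := fun x => by
    rw [((hφ.differentiable one_ne_zero x).hasFDerivAt.pow (k + 1)).fderiv, Pi.smul_apply',
      norm_smul, nsmul_eq_mul, norm_mul, norm_smul, mul_assoc, Real.norm_natCast,
      Nat.add_sub_cancel]
  refine (eLpNorm_le_mul_eLpNorm_of_ae_le_mul (Eventually.of_forall hd) 1).trans ?_
  rw [ENNReal.ofReal_natCast]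
  gcongr
  exact eLpNorm_smul_le_mul_eLpNorm (hφ.continuous_fderiv one_ne_zero).aestronglyMeasurable
    (hφ.continuous.pow k).aestronglyMeasurable

/-- The embedding of `W^{1,1}(ℝ²)` in `L²` is applied to a power of `φ`. Iterating over `k` bounds
all even powers of `φ` in `L¹`, which replaces the missing endpoint embedding. -/
theorem eLpNorm_pow_two_dim_le : ∃ C : ℝ≥0, ∀ (φ : Space 2 → ℝ), ContDiff ℝ 1 φ →
    HasCompactSupport φ → ∀ k : ℕ, eLpNorm (fun x => φ x ^ (k + 1)) 2 volume ≤
      C * ((k + 1 : ℕ) * (eLpNorm (fun x => φ x ^ k) 2 volume *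
        eLpNorm (fderiv ℝ φ) 2 volume)) := by
  refine ⟨SNormLESNormFDerivOfEqConst ℝ (volume : Measure (Space 2)) 1, fun φ hφ hc k => ?_⟩
  have hc' : HasCompactSupport fun x => φ x ^ (k + 1) :=
    hc.comp_left (g := fun y => y ^ (k + 1)) (by simp)
  have := eLpNorm_le_eLpNorm_fderiv_of_eq (F := ℝ) (volume : Measure (Space 2)) (hφ.pow (k + 1))
    hc' (p := 1) (p' := 2) le_rfl (by simp) (by simp; norm_num)
  simp only [ENNReal.coe_one, NNReal.coe_one, ENNReal.coe_ofNat] at this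
  refine this.trans ?_
  gcongr
  exact eLpNorm_fderiv_pow_le hφ k

theorem enorm_le_eLpNorm_fderiv_one_dim {φ : Space 1 → ℝ} (hφ : ContDiff ℝ 1 φ)
    (hc : HasCompactSupport φ) (x : Space 1) : ‖φ x‖ₑ ≤ eLpNorm (fderiv ℝ φ) 1 volume := by
  let e : ℝ ≃ₗᵢ[ℝ] Space 1 := (OrthonormalBasis.singleton (Fin 1) ℝ).repr
  have h1 : ContDiff ℝ 1 (φ ∘ e) := hφ.comp e.contDiff
  have h2 : HasCompactSupport (φ ∘ e) := hc.comp_homeomorph e.toHomeomorph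
  have h3 := h2.enorm_le_lintegral_Ici_deriv h1 (e.symm x)
  simp only [Function.comp_apply, LinearIsometryEquiv.apply_symm_apply] at h3
  refine h3.trans ((setLIntegral_le_lintegral _ _).trans ?_)
  rw [eLpNorm_one_eq_lintegral_enorm, ← e.measurePreserving.lintegral_comp
    ((hφ.continuous_fderiv one_ne_zero).measurable.enorm)]
  refine lintegral_mono fun s => ?_
  have hd : deriv (φ ∘ e) s = fderiv ℝ φ (e s) (e 1) := by
    have h4 : HasDerivAt (fun s => e s) (e 1) s := e.toContinuousLinearEquiv.hasFDerivAt.hasDerivAt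
    exact ((hφ.differentiable one_ne_zero (e s)).hasFDerivAt.comp_hasDerivAt s h4).deriv
  rw [hd, ← ofReal_norm, ← ofReal_norm]
  refine ENNReal.ofReal_le_ofReal (((fderiv ℝ φ (e s)).le_opNorm _).trans ?_)
  simp

theorem abs_rpow_le_add {q r : ℝ} (h2 : 2 ≤ q) (hqr : q ≤ r) (y : ℝ) :
    |y| ^ q ≤ y ^ 2 + |y| ^ r := by
  have hy := abs_nonneg y
  rcases le_total |y| 1 with h | h
  · have := Real.rpow_le_rpow_of_exponent_ge' hy h zero_le_two h2
    rw [Real.rpow_two, sq_abs] at this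
    linarith [Real.rpow_nonneg hy r]
  · linarith [Real.rpow_le_rpow_of_exponent_le h hqr, sq_nonneg y]

theorem integrable_sq (w : L2 d) : Integrable fun x => w x ^ 2 := (Lp.memLp w).integrable_sq

theorem integrable_abs_rpow_of_le {w : L2 d} {q r : ℝ} (h2 : 2 ≤ q) (hqr : q ≤ r)
    (hr : Integrable fun x => |w x| ^ r) : Integrable fun x => |w x| ^ q := by
  have hm : AEStronglyMeasurable (fun x => |w x| ^ q) volume :=
    ((Lp.stronglyMeasurable w).measurable.abs.pow_const q).aestronglyMeasurable
  refine ((integrable_sq w).add hr).mono' hm (Eventually.of_forall fun x => ?_)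
  rw [Real.norm_of_nonneg (Real.rpow_nonneg (abs_nonneg _) _)]
  exact abs_rpow_le_add h2 hqr _

/-- The Sobolev embedding `H¹(ℝ^d) ⊂ L^q(ℝ^d)` for `2 ≤ q`, and `q ≤ 2d/(d-2)` if `d ≥ 3`. -/
theorem H1.integrable_abs_rpow (hd : 1 ≤ d) (u : H1 d) {q : ℝ} (h2 : 2 ≤ q)
    (hq : 3 ≤ d → q ≤ 2 * d / (d - 2)) : Integrable fun x => |u.fn x| ^ q := by
  obtain ⟨φ, A, hA, hφ, hlim⟩ := exists_test_approx u
  have hum := (Lp.stronglyMeasurable u.fn).measurable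
  rcases lt_or_ge d 3 with h3 | h3
  · obtain rfl | rfl : d = 1 ∨ d = 2 := by omega
    -- In dimension one `φ²` is bounded by the `L¹` norm of its derivative, hence by twice the
    -- product of the `L²` norms of `φ` and `φ'`.
    · have hb : ∀ n x, ‖φ n x ^ 2‖ₑ ≤ 2 * (A * A) := fun n x => by
        obtain ⟨p1, p2, p3, p4⟩ := hφ n
        have hc' : HasCompactSupport fun x => φ n x ^ 2 :=
          p2.comp_left (g := fun y => y ^ 2) (by simp)
        refine (enorm_le_eLpNorm_fderiv_one_dim (p1.pow 2) hc' x).trans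
          ((eLpNorm_fderiv_pow_le p1 1).trans ?_)
        simp only [pow_one]
        norm_num
        gcongr
      set M := (2 * (A * A)).toReal with hM
      have hMt : 2 * (A * A) ≠ ⊤ := by finiteness
      have hub : ∀ᵐ x, u.fn x ^ 2 ≤ M := by
        filter_upwards [hlim] with x hx
        refine le_of_tendsto (hx.pow 2) (Eventually.of_forall fun n => ?_)
        have := ENNReal.toReal_mono hMt (hb n x)
        rw [toReal_enorm, Real.norm_of_nonneg (sq_nonneg _)] at this
        exact this
      refine ((integrable_sq u.fn).const_mul (M ^ ((q - 2) / 2))).mono'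
        (hum.abs.pow_const q).aestronglyMeasurable ?_
      filter_upwards [hub] with x hx
      rw [Real.norm_of_nonneg (Real.rpow_nonneg (abs_nonneg _) _)]
      have e : |u.fn x| ^ q = (u.fn x ^ 2) ^ ((q - 2) / 2) * u.fn x ^ 2 := by
        rw [← sq_abs, ← Real.rpow_two, ← Real.rpow_mul (abs_nonneg _),
          ← Real.rpow_add_of_nonneg (abs_nonneg _) (by linarith) (by norm_num)]
        congr 1; ring
      rw [e]
      gcongr
    · obtain ⟨C, hC⟩ := eLpNorm_pow_two_dim_le
      have hb : ∀ k : ℕ, ∃ B : ℝ≥0∞, B ≠ ⊤ ∧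
          ∀ n, eLpNorm (fun x => φ n x ^ (k + 1)) 2 volume ≤ B := by
        intro k
        induction k with
        | zero => exact ⟨A, hA, fun n => by simpa using (hφ n).2.2.1⟩
        | succ k ih =>
          obtain ⟨B, hB, hBn⟩ := ih
          refine ⟨C * ((k + 1 + 1 : ℕ) * (B * A)), by finiteness, fun n => ?_⟩
          refine (hC (φ n) (hφ n).1 (hφ n).2.1 (k + 1)).trans ?_
          gcongr
          · exact hBn n
          · exact (hφ n).2.2.2
      set k := ⌈q⌉₊
      obtain ⟨B, hB, hBn⟩ := hb k
      have hmem : MemLp (fun x => u.fn x ^ (k + 1)) 2 volume := by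
        refine ⟨(hum.pow_const _).aestronglyMeasurable, lt_of_le_of_lt ?_ hB.lt_top⟩
        -- Fatou's lemma: bounded approximants with an almost everywhere limit suffice, without
        -- convergence in `H¹`.
        refine Lp.eLpNorm_le_of_ae_tendsto (u := atTop) (Eventually.of_forall hBn)
          (fun n => ((hφ n).1.continuous.pow _).aestronglyMeasurable) ?_
        filter_upwards [hlim] with x hx using hx.pow _
      refine integrable_abs_rpow_of_le (r := ((2 * (k + 1) : ℕ) : ℝ)) h2 ?_ ?_
      · have := Nat.le_ceil q
        push_cast
        have h0 : (0 : ℝ) ≤ (⌈q⌉₊ : ℝ) := by positivity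
        change q ≤ (⌈q⌉₊ : ℝ) at this
        change q ≤ 2 * ((⌈q⌉₊ : ℝ) + 1)
        linarith
      · refine hmem.integrable_sq.congr (Eventually.of_forall fun x => ?_)
        simp only [Real.rpow_natCast]
        rw [pow_mul, sq_abs, ← pow_mul, ← pow_mul, mul_comm]
  · have hd3 : (3 : ℝ) ≤ d := by exact_mod_cast h3
    set p' : ℝ≥0 := ⟨2 * d / (d - 2), div_nonneg (by positivity) (by linarith)⟩ with hp'
    have hp'v : (p' : ℝ) = 2 * d / (d - 2) := rfl
    have hp'0 : 0 < (p' : ℝ) := by rw [hp'v]; exact div_pos (by positivity) (by linarith)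
    have hb : ∀ n, eLpNorm (φ n) p' volume ≤
        SNormLESNormFDerivOfEqConst ℝ (volume : Measure (Space d)) ((2 : ℝ≥0) : ℝ) * A := fun n => by
      have := eLpNorm_le_eLpNorm_fderiv_of_eq (F := ℝ) (volume : Measure (Space d)) (hφ n).1
        (hφ n).2.1 (p := 2) (p' := p') one_le_two (by simp; omega) (by
          rw [hp'v, finrank_euclideanSpace_fin]
          have : (d : ℝ) - 2 ≠ 0 := by linarith
          rw [NNReal.coe_inv, NNReal.coe_ofNat]
          field_simp)
      refine this.trans ?_
      gcongr
      exact (hφ n).2.2.2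
    have hmem : MemLp u.fn p' volume := by
      refine ⟨hum.aestronglyMeasurable, lt_of_le_of_lt (b :=
        SNormLESNormFDerivOfEqConst ℝ (volume : Measure (Space d)) ((2 : ℝ≥0) : ℝ) * A) ?_
        (ENNReal.mul_lt_top ENNReal.coe_lt_top hA.lt_top)⟩
      exact Lp.eLpNorm_le_of_ae_tendsto (u := atTop) (Eventually.of_forall hb)
        (fun n => (hφ n).1.continuous.aestronglyMeasurable) hlim
    refine integrable_abs_rpow_of_le (r := p') h2 (hq h3) ?_
    have := hmem.integrable_norm_rpow (by simpa using (NNReal.coe_pos.1 hp'0).ne') (by simp)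
    simpa using this

end Sobolev

/-! ### Superposition operators and truncation. -/

section Nemytskii

variable {d : ℕ}

/-- The smooth truncation of `f` to a function supported in `[-(n+2), n+2]`. -/
noncomputable def trunc (f : ℝ → ℝ) (n : ℕ) (y : ℝ) : ℝ :=
  (⟨n + 1, n + 2, by positivity, by linarith⟩ : ContDiffBump (0 : ℝ)) y * f y

theorem trunc_zero {f : ℝ → ℝ} (h0 : f 0 = 0) (n : ℕ) : trunc f n 0 = 0 := by
  simp [trunc, h0]

theorem contDiff_trunc {f : ℝ → ℝ} (hf : ContDiff ℝ 1 f) (n : ℕ) : ContDiff ℝ 1 (trunc f n) :=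
  (ContDiffBump.contDiff _).mul hf

theorem exists_lipschitzWith_trunc {f : ℝ → ℝ} (hf : ContDiff ℝ 1 f) (n : ℕ) :
    ∃ K, LipschitzWith K (trunc f n) :=
  ContDiff.lipschitzWith_of_hasCompactSupport (ContDiffBump.hasCompactSupport _).mul_right
    (contDiff_trunc hf n) one_ne_zero

theorem abs_trunc_le (f : ℝ → ℝ) (n : ℕ) (y : ℝ) : |trunc f n y| ≤ |f y| := by
  rw [trunc, abs_mul, abs_of_nonneg (ContDiffBump.nonneg _)]
  exact mul_le_of_le_one_left (abs_nonneg _) (ContDiffBump.le_one _)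

theorem trunc_eq {f : ℝ → ℝ} {n : ℕ} {y : ℝ} (hy : |y| ≤ n + 1) : trunc f n y = f y := by
  rw [trunc, ContDiffBump.one_of_mem_closedBall, one_mul]
  simpa using hy

theorem eventually_trunc_eq (f : ℝ → ℝ) (R : ℝ) :
    ∀ᶠ n in atTop, ∀ y, |y| ≤ R → trunc f n y = f y := by
  filter_upwards [eventually_ge_atTop ⌈R⌉₊] with n hn y hy
  have : R ≤ n := (Nat.le_ceil _).trans (by exact_mod_cast hn)
  exact trunc_eq (by linarith)

theorem tendsto_trunc (f : ℝ → ℝ) (y : ℝ) :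
    Tendsto (fun n => trunc f n y) atTop (𝓝 (f y)) := by
  refine tendsto_const_nhds.congr' ?_
  filter_upwards [eventually_trunc_eq f |y|] with n hn using (hn y le_rfl).symm

/-- The truncation of index `n` vanishes for `|y| ≥ n + 2`, and the next one equals `f` up to that
radius. -/
theorem monotone_abs_trunc (f : ℝ → ℝ) (y : ℝ) : Monotone fun n => |trunc f n y| := by
  refine monotone_nat_of_le_succ fun n => ?_
  rcases le_or_gt |y| (n + 2) with h | h
  · rw [trunc_eq (n := n + 1) (by push_cast; linarith)]
    exact abs_trunc_le f n y
  · rw [trunc, ContDiffBump.zero_of_le_dist, zero_mul, abs_zero]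
    · exact abs_nonneg _
    · rw [Real.dist_eq, sub_zero]
      exact h.le

/-- The superposition operator of `f` on `L²`, with value `0` where `f ∘ w` is not in `L²`. -/
noncomputable def nemytskii (f : ℝ → ℝ) (w : L2 d) : L2 d :=
  open scoped Classical in
  if h : MemLp (fun x => f (w x)) 2 volume then h.toLp else 0

theorem coeFn_nemytskii {f : ℝ → ℝ} {w : L2 d} (h : MemLp (fun x => f (w x)) 2 volume) :
    nemytskii f w =ᵐ[volume] fun x => f (w x) := by
  rw [nemytskii, dif_pos h]
  exact h.coeFn_toLp

theorem enorm_nemytskii_le (f : ℝ → ℝ) (w : L2 d) :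
    ‖nemytskii f w‖ₑ ≤ eLpNorm (fun x => f (w x)) 2 volume := by
  rw [nemytskii]
  split_ifs with h
  · rw [Lp.enorm_toLp]
  · simp

theorem inner_eq_integral (w z : L2 d) : (inner ℝ w z : ℝ) = ∫ x, w x * z x := by
  rw [L2.inner_def]
  simp [mul_comm]

theorem inner_nemytskii {f : ℝ → ℝ} {w : L2 d} (h : MemLp (fun x => f (w x)) 2 volume)
    (z : L2 d) : (inner ℝ (nemytskii f w) z : ℝ) = ∫ x, f (w x) * z x := by
  rw [inner_eq_integral]
  refine integral_congr_ae ?_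
  filter_upwards [coeFn_nemytskii h] with x hx
  rw [hx]

theorem memLp_comp {g : ℝ → ℝ} {K : ℝ≥0} (hg : LipschitzWith K g) (g0 : g 0 = 0) (w : L2 d) :
    MemLp (fun x => g (w x)) 2 volume := hg.comp_memLp g0 (Lp.memLp w)

theorem nemytskii_eq_compLp {g : ℝ → ℝ} {K : ℝ≥0} (hg : LipschitzWith K g) (g0 : g 0 = 0)
    (w : L2 d) : nemytskii g w = hg.compLp g0 w := by
  refine Lp.ext ?_
  filter_upwards [coeFn_nemytskii (memLp_comp hg g0 w), hg.coeFn_compLp g0 w] with x h1 h2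
  rw [h1, h2]; rfl

theorem continuous_nemytskii {g : ℝ → ℝ} {K : ℝ≥0} (hg : LipschitzWith K g) (g0 : g 0 = 0) :
    Continuous (nemytskii g : L2 d → L2 d) := by
  have : (nemytskii g : L2 d → L2 d) = hg.compLp g0 := funext (nemytskii_eq_compLp hg g0)
  rw [this]
  exact hg.continuous_compLp g0

theorem eLpNorm_nemytskii {f : ℝ → ℝ} {w : L2 d} (h : MemLp (fun x => f (w x)) 2 volume) :
    ‖nemytskii f w‖ₑ = eLpNorm (fun x => f (w x)) 2 volume := by
  rw [nemytskii, dif_pos h, Lp.enorm_toLp]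

variable {f : ℝ → ℝ} (hf : ContDiff ℝ 1 f) (h0 : f 0 = 0)

include hf in
-- Monotone convergence, so an infinite limit is allowed. This makes the norm of `f (U t)`
-- measurable in time before it is known to be finite.
theorem tendsto_eLpNorm_trunc (w : L2 d) :
    Tendsto (fun n => eLpNorm (fun x => trunc f n (w x)) 2 volume) atTop
      (𝓝 (eLpNorm (fun x => f (w x)) 2 volume)) := by
  simp_rw [eLpNorm_two_eq]
  refine ENNReal.continuous_rpow_const.continuousAt.tendsto.comp ?_
  have hw := (Lp.stronglyMeasurable w).measurable
  refine lintegral_tendsto_of_tendsto_of_monotone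
    (fun n => (((contDiff_trunc hf n).continuous.measurable.comp hw).enorm.pow_const
      _).aemeasurable) (Eventually.of_forall fun x => ?_) (Eventually.of_forall fun x => ?_)
  · intro n m hnm
    have := monotone_abs_trunc f (w x) hnm
    simp only
    gcongr
    rw [← ofReal_norm, ← ofReal_norm]
    exact ENNReal.ofReal_le_ofReal this
  · exact ENNReal.continuous_rpow_const.continuousAt.tendsto.comp
      (continuous_enorm.continuousAt.tendsto.comp (tendsto_trunc f (w x)))

include hf h0 in
theorem tendsto_nemytskii_trunc {w : L2 d} (h : MemLp (fun x => f (w x)) 2 volume) :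
    Tendsto (fun n => nemytskii (trunc f n) w) atTop (𝓝 (nemytskii f w)) := by
  have hm : ∀ n, MemLp (fun x => trunc f n (w x)) 2 volume := fun n =>
    memLp_comp (exists_lipschitzWith_trunc hf n).choose_spec (trunc_zero h0 n) w
  have hw := (Lp.stronglyMeasurable w).measurable
  simp only [nemytskii, dif_pos h, dif_pos (hm _)]
  rw [Lp.tendsto_Lp_iff_tendsto_eLpNorm'']
  simp_rw [eLpNorm_two_eq]
  rw [show (𝓝 (0 : ℝ≥0∞)) = 𝓝 ((0 : ℝ≥0∞) ^ (1 / 2 : ℝ)) by norm_num]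
  refine ENNReal.continuous_rpow_const.continuousAt.tendsto.comp ?_
  rw [show (0 : ℝ≥0∞) = ∫⁻ _ : Space d, 0 by simp]
  have hsq := lintegral_rpow_enorm_lt_top_of_eLpNorm_lt_top (p := 2) (by norm_num) (by norm_num)
    h.eLpNorm_lt_top
  simp only [ENNReal.toReal_ofNat] at hsq
  refine tendsto_lintegral_of_dominated_convergence (fun x => ‖f (w x)‖ₑ ^ (2 : ℝ))
    (fun n => ?_) (fun n => Eventually.of_forall fun x => ?_) hsq.ne
    (Eventually.of_forall fun x => ?_)
  · exact ((((contDiff_trunc hf n).continuous.measurable.comp hw).sub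
      (hf.continuous.measurable.comp hw)).enorm.pow_const _)
  · simp only [Pi.sub_apply]
    gcongr
    rw [← ofReal_norm, ← ofReal_norm]
    refine ENNReal.ofReal_le_ofReal ?_
    rw [trunc, ← sub_one_mul, norm_mul]
    refine mul_le_of_le_one_left (norm_nonneg _) ?_
    rw [Real.norm_eq_abs, abs_le]
    constructor
    · linarith [ContDiffBump.nonneg
        (⟨n + 1, n + 2, by positivity, by linarith⟩ : ContDiffBump (0 : ℝ)) (x := w x)]
    · linarith [ContDiffBump.le_one
        (⟨n + 1, n + 2, by positivity, by linarith⟩ : ContDiffBump (0 : ℝ)) (x := w x)]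
  · refine tendsto_const_nhds.congr' ?_
    filter_upwards [eventually_trunc_eq f |w x|] with n hn
    simp [hn (w x) le_rfl]

include hf h0 in
theorem ae_memLp_of_source {U : ℝ → L2 d} (hU : Continuous U) {s : Set ℝ}
    (hs : ∫⁻ t in s, eLpNorm (fun x => f (U t x)) 2 volume < ⊤) :
    ∀ᵐ t ∂volume.restrict s, MemLp (fun x => f (U t x)) 2 volume := by
  have hmeas : Measurable fun t => eLpNorm (fun x => f (U t x)) 2 volume := by
    refine measurable_of_tendsto_metrizable (f := fun n t => eLpNorm (fun x => trunc f n (U t x))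
      2 volume) (fun n => ?_) (tendsto_pi_nhds.2 fun t => tendsto_eLpNorm_trunc hf (U t))
    obtain ⟨K, hK⟩ := exists_lipschitzWith_trunc hf n
    simp_rw [← eLpNorm_nemytskii (memLp_comp hK (trunc_zero h0 n) _)]
    exact ((continuous_nemytskii hK (trunc_zero h0 n)).comp hU).enorm.measurable
  filter_upwards [ae_lt_top hmeas hs.ne] with t ht
  exact ⟨(hf.continuous.measurable.comp
    (Lp.stronglyMeasurable (U t)).measurable).aestronglyMeasurable, ht⟩

include hf h0 in
-- Strong measurability in time comes from the truncations, which are continuous in time and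
-- converge for almost every `t`.
theorem integrableOn_nemytskii {U : ℝ → L2 d} (hU : Continuous U) {s : Set ℝ}
    (hs : ∫⁻ t in s, eLpNorm (fun x => f (U t x)) 2 volume < ⊤) :
    IntegrableOn (fun t => nemytskii f (U t)) s := by
  have hae := ae_memLp_of_source hf h0 hU hs
  refine ⟨aestronglyMeasurable_of_tendsto_ae atTop
    (f := fun n t => nemytskii (trunc f n) (U t)) (fun n => ?_) ?_, ?_⟩
  · obtain ⟨K, hK⟩ := exists_lipschitzWith_trunc hf n
    exact ((continuous_nemytskii hK (trunc_zero h0 n)).comp hU).aestronglyMeasurable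
  · filter_upwards [hae] with t ht using tendsto_nemytskii_trunc hf h0 ht
  · exact (lintegral_mono fun t => enorm_nemytskii_le f (U t)).trans_lt hs

end Nemytskii

/-! ### The potential energy and its chain rule. -/

section Potential

variable {d : ℕ}

theorem abs_primitive_sub_le {g : ℝ → ℝ} {K : ℝ≥0} (hg : LipschitzWith K g) (a b : ℝ) :
    |primitive g (a + b) - primitive g a - g a * b| ≤ K * b ^ 2 := by
  have hi : ∀ a b, IntervalIntegrable g volume a b := fun a b =>
    hg.continuous.intervalIntegrable a b
  have e : primitive g (a + b) - primitive g a - g a * b = ∫ s in a..a + b, (g s - g a) := by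
    rw [intervalIntegral.integral_sub (hi _ _) (by simp), primitive, primitive,
      intervalIntegral.integral_interval_sub_left (hi _ _) (hi _ _)]
    simp [mul_comm]
  rw [e]
  have := intervalIntegral.norm_integral_le_of_norm_le_const (a := a) (b := a + b)
    (f := fun s => g s - g a) (C := K * |b|) (fun s hs => ?_)
  · simp only [add_sub_cancel_left, Real.norm_eq_abs, mul_assoc, ← sq, sq_abs] at this
    exact this
  · refine (hg.norm_sub_le s a).trans ?_
    gcongr
    rw [Real.norm_eq_abs]
    have := abs_sub_left_of_mem_uIcc (uIoc_subset_uIcc hs)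
    simpa using this

theorem continuous_primitive {g : ℝ → ℝ} (hg : Continuous g) : Continuous (primitive g) :=
  intervalIntegral.continuous_primitive (fun a b => hg.intervalIntegrable a b) 0

theorem integrable_primitive {g : ℝ → ℝ} {K : ℝ≥0} (hg : LipschitzWith K g) (g0 : g 0 = 0)
    (w : L2 d) : Integrable fun x => primitive g (w x) := by
  refine ((integrable_sq w).const_mul (K : ℝ)).mono' (((continuous_primitive
    hg.continuous).measurable.comp (Lp.stronglyMeasurable w).measurable).aestronglyMeasurable)
    (Eventually.of_forall fun x => ?_)
  have := abs_primitive_sub_le hg 0 (w x)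
  simpa [g0, primitive] using this

theorem norm_sq_eq_integral (w : L2 d) : ‖w‖ ^ 2 = ∫ x, w x ^ 2 := by
  rw [← real_inner_self_eq_norm_sq, inner_eq_integral]
  simp [sq]

/-- For Lipschitz `g` the first-order Taylor remainder of the primitive is at most `K b²`, so after
integration it is at most `K ‖z - w‖²`. -/
theorem hasFDerivAt_potential {g : ℝ → ℝ} {K : ℝ≥0} (hg : LipschitzWith K g) (g0 : g 0 = 0)
    (w : L2 d) : HasFDerivAt (fun w : L2 d => ∫ x, primitive g (w x))
      (innerSL ℝ (nemytskii g w)) w := by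
  refine HasFDerivAt.of_isLittleO ?_
  have hO : (fun z : L2 d => (∫ x, primitive g (z x)) - (∫ x, primitive g (w x))
      - innerSL ℝ (nemytskii g w) (z - w)) =O[𝓝 w] fun z => ‖z - w‖ ^ 2 := by
    refine Asymptotics.IsBigO.of_bound K (Eventually.of_forall fun z => ?_)
    have hi : Integrable fun x => g (w x) * (z - w) x :=
      MemLp.integrable_mul (p := 2) (q := 2) (memLp_comp hg g0 w) (Lp.memLp _)
    have hi' : Integrable fun x => primitive g (z x) - primitive g (w x) :=
      (integrable_primitive hg g0 z).sub (integrable_primitive hg g0 w)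
    rw [innerSL_apply_apply, inner_nemytskii (memLp_comp hg g0 w),
      ← integral_sub (integrable_primitive hg g0 z) (integrable_primitive hg g0 w),
      ← integral_sub hi' hi,
      norm_pow, norm_norm, norm_sq_eq_integral, ← integral_const_mul]
    refine norm_integral_le_of_norm_le ((integrable_sq _).const_mul _) ?_
    filter_upwards [Lp.coeFn_sub z w] with x hx
    have := abs_primitive_sub_le hg (w x) (z x - w x)
    rw [hx, Pi.sub_apply]
    simpa using this
  refine hO.trans_isLittleO ?_
  have := (Asymptotics.isLittleO_pow_id (𝕜 := ℝ) (n := 2) one_lt_two).comp_tendsto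
    (tendsto_norm_sub_self w)
  exact Asymptotics.isLittleO_norm_right.1 this

theorem abs_primitive_le {g : ℝ → ℝ} {C θ : ℝ} (hC : 0 ≤ C) (hθ : 0 ≤ θ)
    (hg : ∀ y, |g y| ≤ C * (|y| + |y| ^ θ)) (y : ℝ) :
    |primitive g y| ≤ C * (y ^ 2 + |y| ^ (θ + 1)) := by
  have := intervalIntegral.norm_integral_le_of_norm_le_const (a := 0) (b := y)
    (f := g) (C := C * (|y| + |y| ^ θ)) (fun s hs => ?_)
  · rw [sub_zero, Real.norm_eq_abs] at this
    refine this.trans (le_of_eq ?_)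
    rw [Real.rpow_add_one' (abs_nonneg y) (by linarith), ← sq_abs]
    ring
  · have h1 : |s| ≤ |y| := by
      have := abs_sub_left_of_mem_uIcc (uIoc_subset_uIcc hs)
      simpa using this
    refine (hg s).trans ?_
    gcongr

variable {f : ℝ → ℝ} {C θ : ℝ}

theorem integrable_abs_primitive_bound (C : ℝ) {w : L2 d}
    (hw : Integrable fun x => |w x| ^ (θ + 1)) :
    Integrable fun x => C * (w x ^ 2 + |w x| ^ (θ + 1)) :=
  ((integrable_sq w).add hw).const_mul C

theorem integrable_primitive_of_growth (hf : Continuous f) (hC : 0 ≤ C) (hθ : 0 ≤ θ)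
    (hg : ∀ y, |f y| ≤ C * (|y| + |y| ^ θ)) {w : L2 d}
    (hw : Integrable fun x => |w x| ^ (θ + 1)) : Integrable fun x => primitive f (w x) :=
  (integrable_abs_primitive_bound C hw).mono' ((continuous_primitive hf).measurable.comp
    (Lp.stronglyMeasurable w).measurable).aestronglyMeasurable
    (Eventually.of_forall fun x => abs_primitive_le hC hθ hg (w x))

theorem integrable_mul_of_growth (hf : Continuous f)
    (hθ : 0 ≤ θ) (hg : ∀ y, |f y| ≤ C * (|y| + |y| ^ θ)) {w : L2 d}
    (hw : Integrable fun x => |w x| ^ (θ + 1)) : Integrable fun x => w x * f (w x) := by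
  have hm := (Lp.stronglyMeasurable w).measurable
  refine (integrable_abs_primitive_bound C hw).mono'
    (hm.mul (hf.measurable.comp hm)).aestronglyMeasurable (Eventually.of_forall fun x => ?_)
  rw [norm_mul, Real.norm_eq_abs, Real.norm_eq_abs]
  calc |w x| * |f (w x)| ≤ |w x| * (C * (|w x| + |w x| ^ θ)) := by
        gcongr
        exact hg _
    _ = _ := by
        rw [Real.rpow_add_one' (abs_nonneg _) (by linarith), ← sq_abs]
        ring

theorem tendsto_potential_trunc (hf : ContDiff ℝ 1 f) (hC : 0 ≤ C) (hθ : 0 ≤ θ)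
    (hg : ∀ y, |f y| ≤ C * (|y| + |y| ^ θ)) {w : L2 d}
    (hw : Integrable fun x => |w x| ^ (θ + 1)) :
    Tendsto (fun n => ∫ x, primitive (trunc f n) (w x)) atTop (𝓝 (∫ x, primitive f (w x))) := by
  refine tendsto_integral_of_dominated_convergence (fun x => C * (w x ^ 2 + |w x| ^ (θ + 1)))
    (fun n => ?_) (integrable_abs_primitive_bound C hw)
    (fun n => Eventually.of_forall fun x => ?_) (Eventually.of_forall fun x => ?_)
  · exact ((continuous_primitive (contDiff_trunc hf n).continuous).measurable.comp
      (Lp.stronglyMeasurable w).measurable).aestronglyMeasurable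
  · exact abs_primitive_le hC hθ (fun y => (abs_trunc_le f n y).trans (hg y)) (w x)
  · refine tendsto_const_nhds.congr' ?_
    filter_upwards [eventually_trunc_eq f |w x|] with n hn
    refine intervalIntegral.integral_congr fun s hs => (hn s ?_).symm
    have := abs_sub_left_of_mem_uIcc hs
    simpa using this

/-- The chain rule for the potential energy along a curve which is `C¹` in `L²`. -/
theorem potential_sub_eq (hf : ContDiff ℝ 1 f) (h0 : f 0 = 0) (hC : 0 ≤ C) (hθ : 0 ≤ θ)
    (hg : ∀ y, |f y| ≤ C * (|y| + |y| ^ θ)) {U V : ℝ → L2 d} (hU : Continuous U)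
    (hV : Continuous V) (hUV : ∀ t, 0 < t → HasDerivAt U (V t) t)
    (hint : ∀ t, Integrable fun x => |U t x| ^ (θ + 1)) {a b : ℝ} (ha : 0 < a) (hab : a ≤ b)
    (hs : ∫⁻ t in Ioc a b, eLpNorm (fun x => f (U t x)) 2 volume < ⊤) :
    (∫ x, primitive f (U b x)) - ∫ x, primitive f (U a x) =
      ∫ t in a..b, inner ℝ (nemytskii f (U t)) (V t) := by
  have key : ∀ n, (∫ x, primitive (trunc f n) (U b x)) - ∫ x, primitive (trunc f n) (U a x) =
      ∫ t in a..b, inner ℝ (nemytskii (trunc f n) (U t)) (V t) := fun n => by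
    obtain ⟨K, hK⟩ := exists_lipschitzWith_trunc hf n
    have hz := trunc_zero h0 n
    symm
    refine intervalIntegral.integral_eq_sub_of_hasDerivAt
      (f := fun t => ∫ x, primitive (trunc f n) (U t x)) (fun t ht => ?_) ?_
    · rw [uIcc_of_le hab] at ht
      exact (hasFDerivAt_potential hK hz (U t)).comp_hasDerivAt t (hUV t (ha.trans_le ht.1))
    · exact (((continuous_nemytskii hK hz).comp hU).inner hV).intervalIntegrable _ _
  have hL := (tendsto_potential_trunc hf hC hθ hg (hint b)).sub
    (tendsto_potential_trunc hf hC hθ hg (hint a))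
  refine tendsto_nhds_unique hL ?_
  simp_rw [key]
  have hae := ae_memLp_of_source hf h0 hU hs
  have hI := integrableOn_nemytskii hf h0 hU hs
  obtain ⟨M, hM⟩ := (isCompact_Icc (a := a) (b := b)).exists_bound_of_continuousOn hV.continuousOn
  rw [← uIoc_of_le hab] at hae hI
  -- Truncation decreases `|f|`, so the untruncated source, integrable in time, dominates.
  refine intervalIntegral.tendsto_integral_filter_of_dominated_convergence
    (fun t => ‖nemytskii f (U t)‖ * M) (Eventually.of_forall fun n => ?_)
    (Eventually.of_forall fun n => ?_)
    (intervalIntegrable_iff.2 (hI.norm.mul_const M)) ?_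
  · obtain ⟨K, hK⟩ := exists_lipschitzWith_trunc hf n
    exact (((continuous_nemytskii hK (trunc_zero h0 n)).comp hU).inner hV).aestronglyMeasurable
  · rw [ae_restrict_iff' measurableSet_uIoc] at hae
    filter_upwards [hae] with t ht hmem
    have hVt : ‖V t‖ ≤ M := hM t (by
      rw [uIoc_of_le hab] at hmem; exact ⟨hmem.1.le, hmem.2⟩)
    refine (norm_inner_le_norm _ _).trans ?_
    gcongr
    have hm : MemLp (fun x => trunc f n (U t x)) 2 volume :=
      memLp_comp (exists_lipschitzWith_trunc hf n).choose_spec (trunc_zero h0 n) (U t)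
    refine Lp.norm_le_norm_of_ae_le ?_
    filter_upwards [coeFn_nemytskii hm, coeFn_nemytskii (ht hmem)] with x h1 h2
    rw [h1, h2]
    exact abs_trunc_le f n _
  · rw [ae_restrict_iff' measurableSet_uIoc] at hae
    filter_upwards [hae] with t ht hmem
    exact (tendsto_nemytskii_trunc hf h0 (ht hmem)).inner tendsto_const_nhds

end Potential

/-! ### The concavity argument for the damped flow. -/

section BlowUp

theorem sq_le_mul_of_quadratic_nonneg {a b c : ℝ} (h : ∀ x : ℝ, 0 ≤ x ^ 2 * a + 2 * x * b + c) :
    b ^ 2 ≤ a * c := by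
  have := discrim_le_zero (a := a) (b := 2 * b) (c := c) (fun x => by linarith [h x])
  rw [discrim] at this
  linarith

variable {H W : Type*} [NormedAddCommGroup H] [InnerProductSpace ℝ H]
  [NormedAddCommGroup W] [InnerProductSpace ℝ W] {α : ℝ} {ι : W →L[ℝ] H} {V : Submodule ℝ W} {u : ℝ → W} {v g : ℝ → H}

theorem quadratic_norm_nonneg (x : ℝ) (p q : H) :
    0 ≤ x ^ 2 * ‖p‖ ^ 2 + 2 * x * inner ℝ p q + ‖q‖ ^ 2 := by
  have := norm_add_sq_real (x • p) q
  rw [norm_smul, real_inner_smul_left, mul_pow, Real.norm_eq_abs, sq_abs] at this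
  linarith [sq_nonneg ‖x • p + q‖]

/-- The Cauchy–Schwarz inequality behind the concavity argument for the damped equation. -/
theorem sq_pairing_le {p q : ℝ → H} (hp : Continuous p) (hq : Continuous q) (hα : 0 ≤ α)
    {a t : ℝ} (hat : a ≤ t) (k : ℝ) :
    (inner ℝ (p t) (q t) + 2 * α * (∫ s in a..t, inner ℝ (p s) (q s)) + k) ^ 2 ≤
      (‖p t‖ ^ 2 + 2 * α * (∫ s in a..t, ‖p s‖ ^ 2) + k ^ 2) *
        (‖q t‖ ^ 2 + 2 * α * (∫ s in a..t, ‖q s‖ ^ 2) + 1) := by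
  refine sq_le_mul_of_quadratic_nonneg fun x => ?_
  have i1 : IntervalIntegrable (fun s => ‖p s‖ ^ 2) volume a t :=
    (hp.norm.pow 2).intervalIntegrable _ _
  have i2 : IntervalIntegrable (fun s => (inner ℝ (p s) (q s) : ℝ)) volume a t :=
    (hp.inner hq).intervalIntegrable _ _
  have i3 : IntervalIntegrable (fun s => ‖q s‖ ^ 2) volume a t :=
    (hq.norm.pow 2).intervalIntegrable _ _
  have h1 := quadratic_norm_nonneg x (p t) (q t)
  have h2 := intervalIntegral.integral_nonneg (μ := volume) hat
    (fun s _ => quadratic_norm_nonneg x (p s) (q s))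
  rw [intervalIntegral.integral_add ((i1.const_mul _).add (i2.const_mul _)) i3,
    intervalIntegral.integral_add (i1.const_mul _) (i2.const_mul _),
    intervalIntegral.integral_const_mul, intervalIntegral.integral_const_mul] at h2
  have h3 : 0 ≤ 2 * α := by linarith
  -- The quadratic is the squared norm of `x (p, √(2α) p, k) + (q, √(2α) q, 1)`, the middle
  -- component taken in `L²` of the time interval.
  nlinarith [mul_nonneg h3 h2, sq_nonneg (x * k + 1)]

/-- A global flow whose potential satisfies an Ambrosetti–Rabinowitz condition and along which
the Nehari functional stays below a negative constant does not exist. -/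
theorem WeakFlow.false_of_nehari [CompleteSpace H] [CompleteSpace W]
    (hw : WeakFlow α ι V u v g) (hα : 0 ≤ α)
    (hι : ∀ w, ‖ι w‖ ≤ ‖w‖) {Pot X : ℝ → ℝ} {γ δ a : ℝ} (hγ : 0 < γ) (hδ : 0 < δ) (ha : 0 < a)
    (hPot : ∀ t, a ≤ t → Pot t - Pot a = ∫ s in a..t, inner ℝ (g s) (v s))
    (hX : ∀ᵐ t, a ≤ t → inner ℝ (g t) (ι (u t)) = X t)
    (hAR : ∀ t, a ≤ t → 2 * (1 + γ) * Pot t ≤ X t)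
    (hK : ∀ t, a ≤ t → ‖u t‖ ^ 2 - X t ≤ -δ) : False := by
  have cι : Continuous fun t => ι (u t) := ι.continuous.comp hw.cont_u
  set A : ℝ → ℝ := fun t => ‖v t‖ ^ 2 with hA
  set B : ℝ → ℝ := fun t => ‖u t‖ ^ 2 with hB
  set y : ℝ → ℝ := fun t => ‖ι (u t)‖ ^ 2 with hy
  set P : ℝ → ℝ := fun t => inner ℝ (v t) (ι (u t)) with hP
  set N : ℝ → ℝ := fun t => ∫ s in a..t, A s with hN
  set D : ℝ → ℝ := fun t => 2 * P t + 2 * α * y t with hD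
  set E : ℝ := A a + B a - 2 * Pot a with hE
  -- This is `2 (A - B + X)` with `X` replaced by its lower bound `(1 + γ) (A + B - E + 4αN)`, from
  -- condition (i) and the energy identity.
  set m : ℝ → ℝ := fun t => 2 * ((2 + γ) * A t + γ * B t - (1 + γ) * E + 4 * α * (1 + γ) * N t)
    with hm
  have cA : Continuous A := hw.cont_v.norm.pow 2
  have cB : Continuous B := hw.cont_u.norm.pow 2
  have cy : Continuous y := cι.norm.pow 2
  have cP : Continuous P := hw.cont_v.inner cι
  have cN : Continuous N := intervalIntegral.continuous_primitive
    (fun a b => cA.intervalIntegrable a b) a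
  have cm : Continuous m := by
    simp only [hm]
    fun_prop
  have hyd : ∀ t, a ≤ t → HasDerivAt y (2 * P t) t := fun t ht => by
    have := (hw.deriv t (ha.trans_le ht)).norm_sq
    rw [real_inner_comm] at this
    exact this
  have hy_eq : ∀ s t, a ≤ s → s ≤ t → y t - y s = 2 * ∫ r in s..t, P r := fun s t has hst => by
    rw [← intervalIntegral.integral_const_mul]
    refine (intervalIntegral.integral_eq_sub_of_hasDerivAt (fun r hr => hyd r ?_)
      ((cP.const_mul 2).intervalIntegrable _ _)).symm
    rw [uIcc_of_le hst] at hr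
    exact has.trans hr.1
  have hB_y : ∀ t, y t ≤ B t := fun t => by
    simp only [hy, hB]; gcongr; exact hι _
  have henergy : ∀ t, a ≤ t → 2 * Pot t = A t + B t - E + 4 * α * N t := fun t ht => by
    have h1 := hw.energy_eq ha ht
    have h2 := hPot t ht
    simp only [hA, hB, hE, hN]
    rw [← h2] at h1
    linarith
  have iX : ∀ s t, IntervalIntegrable (fun r => (inner ℝ (g r) (ι (u r)) : ℝ)) volume s t :=
    fun s t => intervalIntegrable_inner (hw.int_g s t) cι
  have hD_eq : ∀ s t, a ≤ s → s ≤ t → D t - D s =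
      ∫ r in s..t, 2 * (A r - B r + inner ℝ (g r) (ι (u r))) := fun s t has hst => by
    have h1 := hw.pairing_eq (ha.trans_le has) hst
    have h2 := hy_eq s t has hst
    have iA : IntervalIntegrable A volume s t := cA.intervalIntegrable _ _
    have iB : IntervalIntegrable B volume s t := cB.intervalIntegrable _ _
    rw [intervalIntegral.integral_const_mul, intervalIntegral.integral_add (iA.sub iB) (iX s t),
      intervalIntegral.integral_sub iA iB]
    simp only [hD]
    linear_combination 2 * h1 + 2 * α * h2
  -- The pairing with the source is only known to equal `X` at almost every time, so lower bounds on
  -- `D'` are used in integrated form.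
  have hD_ge : ∀ (q : ℝ → ℝ), Continuous q → (∀ t, a ≤ t → q t ≤ 2 * (A t - B t + X t)) →
      ∀ s t, a ≤ s → s ≤ t → D s + ∫ r in s..t, q r ≤ D t := fun q hq hle s t has hst => by
    have := hD_eq s t has hst
    have h2 : ∫ r in s..t, q r ≤ ∫ r in s..t, 2 * (A r - B r + inner ℝ (g r) (ι (u r))) := by
      refine intervalIntegral.integral_mono_ae_restrict hst (hq.intervalIntegrable _ _)
        ((((cA.sub cB).intervalIntegrable _ _).add (iX s t)).const_mul 2) ?_
      refine (ae_restrict_iff' measurableSet_Icc).2 ?_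
      filter_upwards [hX] with r hr hmem
      have har := has.trans hmem.1
      rw [hr har]
      exact hle r har
    linarith
  have hDδ := hD_ge (fun _ => 2 * δ) continuous_const fun t ht => by
    have := hK t ht
    have : 0 ≤ A t := sq_nonneg _
    simp only [hB]
    linarith
  have hDm := hD_ge m cm fun t ht => by
    have h1 := henergy t ht
    have h2 := hAR t ht
    simp only [hm]
    nlinarith
  have hDtop : Tendsto D atTop atTop := by
    have h1 : Tendsto (fun t => D a + 2 * δ * (t - a)) atTop atTop :=
      tendsto_atTop_add_const_left _ _ (Tendsto.const_mul_atTop (by linarith)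
        (tendsto_atTop_add_const_right _ _ tendsto_id))
    refine tendsto_atTop_mono' _ ?_ h1
    filter_upwards [eventually_ge_atTop a] with t ht
    have := hDδ a t le_rfl ht
    simp only [intervalIntegral.integral_const, smul_eq_mul] at this
    linarith
  -- The threshold is the value at which `γ y`, hence `γ B`, absorbs the constants of `hmQ`.
  have hybig := eventually_ge_of_damped hα ha.le hyd hDtop
    (((1 + γ) * E + (2 + γ) * (α * y a) ^ 2) / γ)
  obtain ⟨b, hb⟩ := eventually_atTop.1
    ((hybig.and (hDtop.eventually_gt_atTop 0)).and (eventually_ge_atTop a))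
  have hab : a ≤ b := (hb b le_rfl).2
  -- The summand `1` is paired in Cauchy–Schwarz with the constant `α y(a)` that appears when `2αy`
  -- in `D` is written as an integral from `a`.
  refine false_of_concavity (Φ := fun t => y t + 2 * α * (∫ s in a..t, y s) + 1) (D := D) (m := m)
    (κ := γ / 2) (a := b) (by positivity) (fun t ht => ?_) (fun t ht => ?_) cm
    (fun t ht => hDm b t hab ht) (hb b le_rfl).1.2 (fun t ht => ?_)
  · exact ((hyd t (hab.trans ht)).add
      (((cy.integral_hasStrictDerivAt a t).hasDerivAt).const_mul (2 * α))).add_const 1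
  · have h1 : 0 ≤ y t := sq_nonneg _
    have h2 : 0 ≤ ∫ s in a..t, y s :=
      intervalIntegral.integral_nonneg (hab.trans ht) fun s _ => sq_nonneg _
    positivity
  · have hat := hab.trans ht
    have hcs := sq_pairing_le hw.cont_v cι hα hat (α * y a)
    have hN0 : 0 ≤ N t := intervalIntegral.integral_nonneg hat fun s _ => sq_nonneg _
    have hYt := (hb t ht).1.1
    rw [div_le_iff₀ hγ] at hYt
    have hDe : D t = 2 * (P t + 2 * α * (∫ s in a..t, P s) + α * y a) := by
      have := hy_eq a t le_rfl hat
      simp only [hD]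
      linear_combination 2 * α * this
    have hΦ0 : 0 ≤ y t + 2 * α * (∫ s in a..t, y s) + 1 := by
      have h1 : 0 ≤ y t := sq_nonneg _
      have h2 : 0 ≤ ∫ s in a..t, y s :=
        intervalIntegral.integral_nonneg hat fun s _ => sq_nonneg _
      positivity
    -- The `A` terms agree, the `N` terms leave `4αγN ≥ 0`, and the constants are covered by `2γB ≥
    -- 2γy`.
    have hmQ : (4 + 2 * γ) * (A t + 2 * α * N t + (α * y a) ^ 2) ≤ m t := by
      have h1 := hB_y t
      have h2 : 0 ≤ α * γ * N t := by positivity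
      simp only [hm]
      nlinarith
    calc (1 + γ / 2) * D t ^ 2
        = (4 + 2 * γ) * (P t + 2 * α * (∫ s in a..t, P s) + α * y a) ^ 2 := by rw [hDe]; ring
      _ ≤ (4 + 2 * γ) * ((A t + 2 * α * N t + (α * y a) ^ 2) *
          (y t + 2 * α * (∫ s in a..t, y s) + 1)) := by
          exact mul_le_mul_of_nonneg_left hcs (by linarith)
      _ = (4 + 2 * γ) * (A t + 2 * α * N t + (α * y a) ^ 2) *
          (y t + 2 * α * (∫ s in a..t, y s) + 1) := by ring
      _ ≤ _ := mul_le_mul_of_nonneg_right hmQ hΦ0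

end BlowUp

/-! ### Consequences of the growth condition. -/

section Growth

/-- Mean value inequality on `[-|y|, |y|]`, after bounding the maximum of the two powers by `1 + |y|
^ (θ - 1)`. -/
theorem SubcriticalGrowth.exists_bound {d : ℕ} {f : ℝ → ℝ} (hG : SubcriticalGrowth d f)
    (hf : ContDiff ℝ 1 f) (h0 : f 0 = 0) : ∃ C θ : ℝ, 0 ≤ C ∧ 1 < θ ∧
      (3 ≤ d → θ < ((d : ℝ) + 2) / ((d : ℝ) - 2)) ∧ ∀ y, |f y| ≤ C * (|y| + |y| ^ θ) := by
  obtain ⟨C, β, θ, hθ, hd, hβ, hβθ, hC⟩ := hG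
  refine ⟨|C|, θ, abs_nonneg _, hθ, hd, fun y => ?_⟩
  have hder : ∀ z ∈ Metric.closedBall (0 : ℝ) |y|,
      ‖deriv f z‖ ≤ |C| * (1 + |y| ^ (θ - 1)) := fun z hz => by
    rw [mem_closedBall_zero_iff, Real.norm_eq_abs] at hz
    have h1 : |z| ^ (θ - 1) ≤ |y| ^ (θ - 1) := Real.rpow_le_rpow (abs_nonneg _) hz (by linarith)
    have h2 : max (|z| ^ β) (|z| ^ (θ - 1)) ≤ 1 + |y| ^ (θ - 1) := by
      have h3 := Real.rpow_nonneg (abs_nonneg z) (θ - 1)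
      refine max_le ?_ (by linarith)
      rcases le_total |z| 1 with h | h
      · linarith [Real.rpow_le_one (abs_nonneg z) h hβ.le]
      · linarith [Real.rpow_le_rpow_of_exponent_le h hβθ.le]
    refine (hC z).trans ?_
    have h4 : 0 ≤ max (|z| ^ β) (|z| ^ (θ - 1)) :=
      (Real.rpow_nonneg (abs_nonneg z) β).trans (le_max_left _ _)
    gcongr
    exact le_abs_self C
  have := (convex_closedBall (0 : ℝ) |y|).norm_image_sub_le_of_norm_deriv_le (f := f)
    (fun z _ => hf.differentiable one_ne_zero z) hder (x := 0) (y := y) (by simp) (by simp)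
  rw [h0, sub_zero, sub_zero, Real.norm_eq_abs, Real.norm_eq_abs] at this
  refine this.trans (le_of_eq ?_)
  have e : |y| ^ θ = |y| ^ (θ - 1) * |y| := by
    rw [← Real.rpow_add_one' (abs_nonneg _) (by linarith)]; congr 1; ring
  rw [e]; ring

/-- The critical exponents match: `(d + 2)/(d - 2) + 1 = 2d/(d - 2)`. -/
theorem H1.integrable_of_subcritical {d : ℕ} (hd : 1 ≤ d) {θ : ℝ} (hθ : 1 < θ)
    (hθd : 3 ≤ d → θ < ((d : ℝ) + 2) / ((d : ℝ) - 2)) (w : H1 d) :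
    Integrable fun x => |w.fn x| ^ (θ + 1) := by
  refine H1.integrable_abs_rpow hd w (by linarith) fun h3 => ?_
  have h3' : (0 : ℝ) < d - 2 := by
    have : (3 : ℝ) ≤ d := by exact_mod_cast h3
    linarith
  have := hθd h3
  rw [lt_div_iff₀ h3'] at this
  rw [le_div_iff₀ h3']
  linarith

end Growth

/-! ### From global solutions to weak flows, and the conclusion. -/

section Solution

variable {d : ℕ}

theorem timeInterval_top : timeInterval ⊤ = Ici 0 := by
  ext t
  simp [timeInterval]

theorem norm_sq_H1 (w : H1 d) :
    ‖(w : WithLp 2 (L2 d × L2Field d))‖ ^ 2 = ∫ x, (‖w.grad x‖ ^ 2 + w.fn x ^ 2) := by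
  have h1 : ‖w.grad‖ ^ 2 = ∫ x, ‖w.grad x‖ ^ 2 := by
    rw [← real_inner_self_eq_norm_sq, L2.inner_def]
    simp
  rw [WithLp.prod_norm_sq_eq_of_L2, norm_sq_eq_integral, h1, add_comm,
    ← integral_add ((memLp_two_iff_integrable_sq_norm (Lp.aestronglyMeasurable _)).1
      (Lp.memLp w.grad)) (integrable_sq _)]

theorem K0_eq {f : ℝ → ℝ} {w : H1 d} (hint : Integrable fun x => w.fn x * f (w.fn x)) :
    K0 f w = ‖(w : WithLp 2 (L2 d × L2Field d))‖ ^ 2 - ∫ x, w.fn x * f (w.fn x) := by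
  have hi : Integrable fun x => ‖w.grad x‖ ^ 2 + w.fn x ^ 2 := ((memLp_two_iff_integrable_sq_norm
    (Lp.aestronglyMeasurable _)).1 (Lp.memLp w.grad)).add (integrable_sq _)
  rw [norm_sq_H1, ← integral_sub hi hint]
  rfl

/-- The source term of a solution, as a function of time with values in `L²`. -/
noncomputable def sourceTerm (f : ℝ → ℝ) (u : ℝ → H1 d) : ℝ → L2 d :=
  (Ici (0 : ℝ)).indicator fun t => nemytskii f (u (max t 0)).fn

theorem sourceTerm_of_nonneg (f : ℝ → ℝ) (u : ℝ → H1 d) {t : ℝ} (ht : 0 ≤ t) :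
    sourceTerm f u t = nemytskii f (u t).fn := by
  rw [sourceTerm, indicator_of_mem (mem_Ici.2 ht), max_eq_left ht]

namespace IsSolution

variable {α : ℝ} {f : ℝ → ℝ} {u : ℝ → H1 d} {v : ℝ → L2 d}

theorem continuous_comp_max {X : Type*} [TopologicalSpace X] {w : ℝ → X}
    (hw : ContinuousOn w (timeInterval ⊤)) : Continuous fun t => w (max t 0) := by
  rw [timeInterval_top] at hw
  exact hw.comp_continuous (continuous_id.max continuous_const) fun t => mem_Ici.2 (le_max_right _ _)

theorem continuous_fn (hu : IsSolution α f ⊤ u v) : Continuous fun t => (u (max t 0)).fn :=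
  (WithLp.fstL 2 ℝ (L2 d) (L2Field d)).continuous.comp
    (continuous_subtype_val.comp (continuous_comp_max hu.continuousOn_u))

theorem lintegral_source (hu : IsSolution α f ⊤ u v) (b : ℝ) :
    ∫⁻ t in Icc 0 b, eLpNorm (fun x => f ((u (max t 0)).fn x)) 2 volume < ⊤ := by
  rcases le_or_gt 0 b with hb | hb
  · refine lt_of_eq_of_lt (setLIntegral_congr_fun measurableSet_Icc fun t ht => ?_)
      (hu.source b (by rw [timeInterval_top]; exact hb))
    simp only [max_eq_left ht.1]
  · simp [Icc_eq_empty_of_lt hb]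

theorem ae_memLp (hf : ContDiff ℝ 1 f) (h0 : f 0 = 0) (hu : IsSolution α f ⊤ u v) :
    ∀ᵐ t, 0 ≤ t → MemLp (fun x => f ((u t).fn x)) 2 volume := by
  have : ∀ᵐ t, ∀ n : ℕ, t ∈ Icc (0 : ℝ) n → MemLp (fun x => f ((u (max t 0)).fn x)) 2 volume :=
    ae_all_iff.2 fun n => (ae_restrict_iff' measurableSet_Icc).1
      (ae_memLp_of_source hf h0 hu.continuous_fn (hu.lintegral_source n))
  filter_upwards [this] with t ht ht0
  have := ht ⌈t⌉₊ ⟨ht0, Nat.le_ceil t⟩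
  rwa [max_eq_left ht0] at this

theorem intervalIntegrable_sourceTerm (hf : ContDiff ℝ 1 f) (h0 : f 0 = 0)
    (hu : IsSolution α f ⊤ u v) (a b : ℝ) : IntervalIntegrable (sourceTerm f u) volume a b := by
  rw [intervalIntegrable_iff]
  have hI := (integrableOn_nemytskii hf h0 hu.continuous_fn
    (hu.lintegral_source (max a b))).integrable_indicator measurableSet_Icc
  refine IntegrableOn.congr_fun hI.integrableOn (fun t ht => ?_) measurableSet_uIoc
  rw [sourceTerm, indicator_apply, indicator_apply]
  have : t ≤ max a b := ht.2
  simp [this]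

/-- Freezing `u` and `v` at their initial values for negative times gives continuous functions on
the whole line, so that the averages make sense. -/
theorem weakFlow (hf : ContDiff ℝ 1 f) (h0 : f 0 = 0) (hu : IsSolution α f ⊤ u v) :
    WeakFlow α (WithLp.fstL 2 ℝ (L2 d) (L2Field d)) (sobolevGraph d)
      (fun t => (u (max t 0) : WithLp 2 (L2 d × L2Field d))) (fun t => v (max t 0))
      (sourceTerm f u) where
  mem t := (u _).2
  cont_u := continuous_subtype_val.comp (continuous_comp_max hu.continuousOn_u)
  cont_v := continuous_comp_max hu.continuousOn_v
  int_g := hu.intervalIntegrable_sourceTerm hf h0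
  deriv t ht := by
    have h := hu.hasDeriv t (by rw [timeInterval_top]; exact ht.le)
    rw [timeInterval_top] at h
    rw [max_eq_left ht.le]
    refine (h.hasDerivAt (Ici_mem_nhds ht)).congr_of_eventuallyEq ?_
    filter_upwards [Ici_mem_nhds ht] with s hs
    rw [max_eq_left hs]
    rfl
  eqn φ hφ s t hs hst := by
    set φ' : H1 d := ⟨φ, hφ⟩ with hφ'
    set J : ℝ → ℝ := fun r => -(2 * α * inner ℝ (v (max r 0)) (WithLp.fstL 2 ℝ (L2 d)
      (L2Field d) φ)) - inner ℝ (u (max r 0) : WithLp 2 (L2 d × L2Field d)) φ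
      + inner ℝ (sourceTerm f u r) (WithLp.fstL 2 ℝ (L2 d) (L2Field d) φ) with hJ
    have hJi : ∀ a b, IntervalIntegrable J volume a b := fun a b => by
      have c1 := continuous_comp_max hu.continuousOn_v
      have c2 : Continuous fun t => (u (max t 0) : WithLp 2 (L2 d × L2Field d)) :=
        continuous_subtype_val.comp (continuous_comp_max hu.continuousOn_u)
      refine IntervalIntegrable.add ?_ (intervalIntegrable_inner
        (hu.intervalIntegrable_sourceTerm hf h0 a b) continuous_const)
      exact (((continuous_const.mul (c1.inner continuous_const)).neg).sub
        (c2.inner continuous_const)).intervalIntegrable _ _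
    have key : ∀ t, 0 ≤ t → inner ℝ (v t) φ'.fn - inner ℝ (v 0) φ'.fn =
        ∫ r in (0 : ℝ)..t, J r := fun t ht => by
      rw [hu.equation φ' t (by rw [timeInterval_top]; exact ht)]
      refine intervalIntegral.integral_congr_ae ?_
      filter_upwards [hu.ae_memLp hf h0] with r hr hmem
      rw [uIoc_of_le ht] at hmem
      have hr0 : 0 ≤ r := hmem.1.le
      simp only [hJ]
      rw [sourceTerm_of_nonneg f u hr0, max_eq_left hr0, WithLp.prod_inner_apply]
      have := inner_nemytskii (hr hr0) φ'.fn
      rw [← this, sub_sub, add_comm (inner ℝ (u r).grad φ'.grad)]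
      rfl
    have h1 := key t (hs.trans hst)
    have h2 := key s hs
    rw [max_eq_left hs, max_eq_left (hs.trans hst), ← intervalIntegral.integral_interval_sub_left
      (hJi 0 t) (hJi 0 s), ← h1, ← h2]
    change _ = inner ℝ (v t) φ'.fn - inner ℝ (v 0) φ'.fn -
      (inner ℝ (v s) φ'.fn - inner ℝ (v 0) φ'.fn)
    rw [sub_sub_sub_cancel_right]
    rfl

/-- There is no global solution along which `K₀` stays below a negative constant. -/
theorem false_of_K0_le (hd : 1 ≤ d) (hα : 0 ≤ α) (hf : ContDiff ℝ 1 f) (h0 : f 0 = 0)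
    (hAR : AmbrosettiRabinowitz d f) (hG : SubcriticalGrowth d f) (hu : IsSolution α f ⊤ u v)
    {a δ : ℝ} (ha : 0 < a) (hδ : 0 < δ) (hK : ∀ t, a ≤ t → K0 f (u t) ≤ -δ) : False := by
  obtain ⟨C, θ, hC, hθ, hθd, hg⟩ := hG.exists_bound hf h0
  obtain ⟨γ, hγ, hAR⟩ := hAR
  have hθ0 : 0 ≤ θ := by linarith
  have hint := H1.integrable_of_subcritical hd hθ hθd
  have hw := hu.weakFlow hf h0
  have hi1 : ∀ w : H1 d, Integrable fun x => w.fn x * f (w.fn x) := fun w =>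
    integrable_mul_of_growth hf.continuous hθ0 hg (hint w)
  have hi2 : ∀ w : H1 d, Integrable fun x => primitive f (w.fn x) := fun w =>
    integrable_primitive_of_growth hf.continuous hC hθ0 hg (hint w)
  refine hw.false_of_nehari hα (fun w => ?_)
    (Pot := fun t => ∫ x, primitive f ((u (max t 0)).fn x))
    (X := fun t => ∫ x, (u (max t 0)).fn x * f ((u (max t 0)).fn x))
    hγ hδ ha (fun t ht => ?_) ?_ (fun t ht => ?_) (fun t ht => ?_)
  · exact WithLp.norm_fst_le _ w
  · refine (potential_sub_eq hf h0 hC hθ0 hg hu.continuous_fn hw.cont_v hw.deriv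
      (fun t => hint (u (max t 0))) ha ht ((lintegral_mono_set fun s hs => ?_).trans_lt
        (hu.lintegral_source t))).trans ?_
    · exact ⟨ha.le.trans hs.1.le, hs.2⟩
    · refine intervalIntegral.integral_congr fun s hs => ?_
      rw [uIcc_of_le ht] at hs
      have hs0 := ha.le.trans hs.1
      simp only [max_eq_left hs0, sourceTerm_of_nonneg f u hs0]
  · filter_upwards [hu.ae_memLp hf h0] with t ht hat
    have ht0 := ha.le.trans hat
    rw [sourceTerm_of_nonneg f u ht0, max_eq_left ht0]
    refine (inner_nemytskii (ht ht0) _).trans ?_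
    simp_rw [mul_comm (f _)]
    rfl
  · have := hAR (u (max t 0))
    rw [integral_sub ((hi2 _).const_mul _) (hi1 _), integral_const_mul] at this
    linarith
  · have := hK t ht
    rw [K0_eq (hi1 _)] at this
    simpa only [max_eq_left (ha.le.trans ht)] using this

end IsSolution

end Solution
end KleinGordon

theorem lemma2p7 (d : ℕ) (hd : 1 ≤ d) (hd6 : d ≤ 6) (α : ℝ) (hα : 0 ≤ α)
    (f : ℝ → ℝ) (hf : ContDiff ℝ 1 f) (hodd : ∀ y, f (-y) = -f y) (hf0 : deriv f 0 = 0)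
    (hAR : KleinGordon.AmbrosettiRabinowitz d f) (hG : KleinGordon.SubcriticalGrowth d f)
    (T : EReal) (u : ℝ → KleinGordon.H1 d) (v : ℝ → KleinGordon.L2 d)
    (hu : KleinGordon.IsMaximalSolution α f T u v)
    (t₀ : ℝ) (ht₀ : t₀ ∈ KleinGordon.timeInterval T) (δ : ℝ) (hδ : 0 < δ)
    (hK : ∀ t ∈ KleinGordon.timeInterval T, t₀ ≤ t → KleinGordon.K0 f (u t) ≤ -δ) :
    T < ⊤ := by
  rw [lt_top_iff_ne_top]
  rintro rfl
  have h0 : f 0 = 0 := by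
    have := hodd 0
    rw [neg_zero] at this
    linarith
  rw [KleinGordon.timeInterval_top] at ht₀ hK
  have ht₀' : 0 ≤ t₀ := ht₀
  -- The shift by `1` makes the starting time positive even if `t₀ = 0`, where the time derivative
  -- is only one-sided.
  exact hu.isSolution.false_of_K0_le hd hα hf h0 hAR hG (a := t₀ + 1) (by linarith) hδ
    fun t ht => hK t (mem_Ici.2 (by linarith)) (by linarith)
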